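/- Conventions. Work in the Euclidean space $\mathbb{R}^d$; "smooth" means $C^2$. For $A\subset\mathbb{R}^d$ let $d_A(y)=\inf_{a\in A}\|y-a\|$ and $\complement A=\overline{\mathbb{R}^d\setminus A}$; for $r>0$ let $A^{-r}=\{y : d_{\complement A}(y)\ge r\}$. The reach of a closed set $A$ is the supremum of the $t\ge 0$ such that every $y$ with $d_A(y)<t$ has a unique closest point in $A$. The Clarke gradient $\partial^*\phi(y)$ of a locally Lipschitz $\phi$ is the convex hull of the limits of $\nabla\phi(y_i)$, $y_i\to y$, where $\phi$ is differentiable at each $y_i$; for $\mu\in(0,1]$, $\mathrm{reach}_\mu(A)$ is the supremum of the $s\ge 0$ such that every element of $\partial^* d_A(y)$ has norm at least $\mu$ whenever $0<d_A(y)\le s$. A compact set $X$ is *complementary regular* if $\overline{\mathrm{int}(X)}=X$, $\mathrm{reach}_\mu(X)>0$ for some $\mu\in(0,1]$, and $\mathrm{reach}(\complement X)>0$. $\mathrm{Tan}(A,y)$ is the cone of tangent vectors to $A$ at $y\in A$: $0$ and all nonnegative multiples of limits of $(y_i-y)/\|y_i-y\|$ with $y_i\in A\setminus\{y\}$, $y_i\to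 y$. If $A$ has positive reach, $\mathrm{Nor}(A,y)$ is the polar cone $\mathrm{Tan}(A,y)^{\mathrm{o}}$. If $\complement X$ has positive reach and is fully dimensional (its tangent cones at boundary points span $\mathbb{R}^d$; equivalently it is a Lipschitz domain), we say that $X$ admits a normal bundle, and put $\mathrm{Nor}(X,y)=-\mathrm{Nor}(\complement X,y)$ for $y\in\partial X$ and $\mathrm{Nor}(X,y)=\{0\}$ for $y\in\mathrm{int}(X)$. In both cases the unit normal bundle is $\mathrm{Nor}(X)=\{(y,n): y\in\partial X,\ n\in\mathrm{Nor}(X,y),\ \|n\|=1\}$. A pair $(y,n)\in\mathrm{Nor}(X)$ is *regular* if $T=\mathrm{Tan}(\mathrm{Nor}(X),(y,n))$ is a vector space of dimension $d-1$. The *principal curvatures* at $(y,n)$ are $\kappa_1,\dots,\kappa_{d-1}\in\mathbb{R}\cup\{\infty\}$ for which there are $b_1,\dots,b_{d-1}\perp n$ such that the vectors $\big(\tfrac{1}{\sqrt{1+\kappa_i^2}}b_i,\tfrac{\kappa_i}{\sqrt{1+\kappa_i^2}}b_i\big)$ (read as $(0,b_i)$ if $\kappa_i=\infty$) form an orthonormal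 basis of $T$. Let $f:\mathbb{R}^d\to\mathbb{R}$ be smooth. A point $y\in X$ is a *critical point* of $f_{|X}$ if $\nabla f(y)\in-\mathrm{Nor}(X,y)$. If $\nabla f(y)\ne0$ and $(y,-\nabla f(y)/\|\nabla f(y)\|)$ is a regular pair of $\mathrm{Nor}(X)$ with tangent space $T$, the Hessian of $f_{|X}$ at $y$ is the bilinear form on $\pi_0(T)=\{u:(u,v)\in T\}$ given by $H_yf_{|X}(u,u')=H_yf(u,u')+\|\nabla f(y)\|\langle u,v'\rangle$ where $(u',v')\in T$; its index is the largest dimension of a subspace on which it is negative definite. A critical point $y$ is *non-degenerate* if $\nabla f(y)\neq 0$, that pair is regular, and this Hessian is non-degenerate. **Lemma.** Let $X\subset\mathbb{R}^d$ be complementary regular, $f:\mathbb{R}^d\to\mathbb{R}$ smooth, and $x$ a non-degenerate critical point of $f_{|X}$. Put $\nu=\nabla f(x)/\|\nabla f(x)\|$ and, for $r>0$, $f_r(y)=f(y-r\nu)$ and $x^r=x+r\nu$. 1. For all $0<r<\mathrm{reach}(\complement X)$, the set $X^{-r}$ admits a normal bundle, $x^r$ is a critical point of $f_{r|X^{-r}}$,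 and $f_r(x^r)=f(x)$. 2. The set $\complement X$ (of positive reach) has a family of principal curvatures at $(x,\nu)$, and there is $r_0>0$ such that for all $0<r<r_0$ the point $x^r$ is a non-degenerate critical point of $f_{r|X^{-r}}$, and the index of the Hessian of $f_{r|X^{-r}}$ at $x^r$ equals the index of the Hessian of $f_{|X}$ at $x$ plus the number of infinite principal curvatures of $\complement X$ at $(x,\nu)$ (for every family of principal curvatures there). -/

import Mathlib

open Filter Topology
open scoped NNReal ENNReal RealInnerProductSpace

noncomputable section

namespace ComplementaryRegular

/-! ### Sets, distance functions, reach -/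

/-- The Euclidean space `ℝ^d`. -/
abbrev E (d : ℕ) : Type := EuclideanSpace ℝ (Fin d)

variable {d : ℕ}

/-- The complement set of `X`: the closure of the set-theoretic complement. -/
def closedCompl (X : Set (E d)) : Set (E d) := closure Xᶜ

/-- The eroded set (counter-offset) `X^{-r}`: the points at distance at least `r` from the
complement set of `X`. -/
def erosion (X : Set (E d)) (r : ℝ) : Set (E d) := {x | r ≤ Metric.infDist x (closedCompl X)}

/-- The Clarke gradient of `φ` at `x`: the convex hull of all limits of gradients `∇φ(x_i)` along
sequences `x_i → x` of points of differentiability of `φ`. -/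
def clarkeGradient (φ : E d → ℝ) (x : E d) : Set (E d) :=
  convexHull ℝ {v | ∃ u : ℕ → E d, (∀ i, DifferentiableAt ℝ φ (u i)) ∧
    Tendsto u atTop (𝓝 x) ∧ Tendsto (fun i => gradient φ (u i)) atTop (𝓝 v)}

/-- The `μ`-reach of `X`: the supremum of the `s ≥ 0` such that, at every point `x ∉ X` with
`d_X(x) ≤ s`, all elements of the Clarke gradient of `d_X` have norm at least `μ`. -/
def muReach (μ : ℝ) (X : Set (E d)) : ℝ≥0∞ :=
  sSup {t | ∃ s : ℝ≥0, t = s ∧ ∀ x : E d, 0 < Metric.infDist x X → Metric.infDist x X ≤ s →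
    μ ≤ Metric.infDist 0 (clarkeGradient (fun y => Metric.infDist y X) x)}

/-- The reach of a (closed) set `A`: the largest `t` such that every `x` with `d_A(x) < t` has a
unique closest point in `A`. -/
def reach (A : Set (E d)) : ℝ≥0∞ :=
  sSup {t | ∃ s : ℝ≥0, t = s ∧ ∀ x : E d, Metric.infDist x A < s →
    ∃! a, a ∈ A ∧ dist x a = Metric.infDist x A}

/-- Complementary regular sets. -/
structure IsComplementaryRegular (X : Set (E d)) : Prop where
  isCompact : IsCompact X
  closure_interior : closure (interior X) = X
  muReach_pos : ∃ μ : ℝ, 0 < μ ∧ μ ≤ 1 ∧ 0 < muReach μ X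
  reach_compl_pos : 0 < reach (closedCompl X)

/-! ### Tangent cones, normal cones, normal bundles -/

/-- The tangent cone `Tan(A, x)`, for `x ∈ A`: the vectors `lim c_i • (x_i - x)` with `c_i ≥ 0`,
`x_i ∈ A` and `x_i → x`, i.e. `0` together with the nonnegative multiples of the limits of
`(x_i - x) / ‖x_i - x‖` for `x_i ∈ A \ {x}` and `x_i → x`. -/
def tangentCone {V : Type*} [NormedAddCommGroup V] [NormedSpace ℝ V] (A : Set V) (x : V) : Set V :=
  tangentConeAt ℝ≥0 A x

/-- The polar cone of `B`. -/
def polarCone (B : Set (E d)) : Set (E d) := {u | ∀ b ∈ B, ⟪u, b⟫ ≤ 0}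

/-- A set (of positive reach) is fully dimensional when all its tangent cones at boundary points
span the whole space; for sets of positive reach this means being a Lipschitz domain. -/
def IsFullyDimensional (A : Set (E d)) : Prop :=
  ∀ x ∈ frontier A, Submodule.span ℝ (tangentCone A x) = ⊤

/-- The normal cone `Nor(A, x) = Tan(A, x)°` of a set `A` of positive reach at `x ∈ A`. -/
def normalConeOfReach (A : Set (E d)) (x : E d) : Set (E d) := polarCone (tangentCone A x)

/-- The unit normal bundle of a set of positive reach. -/
def normalBundleOfReach (A : Set (E d)) : Set (E d × E d) :=
  {p | p.1 ∈ frontier A ∧ p.2 ∈ normalConeOfReach A p.1 ∧ ‖p.2‖ = 1}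

open Classical in
/-- The normal cone `Nor(X, x)` at `x ∈ X` of a set `X` whose complement set has positive reach:
`Nor(X, x) = - Nor(closedCompl X, x)` at boundary points, and `{0}` at interior points. -/
def normalCone (X : Set (E d)) (x : E d) : Set (E d) :=
  if x ∈ interior X then {0} else {u | -u ∈ normalConeOfReach (closedCompl X) x}

/-- The unit normal bundle `Nor(X)` of a set whose complement set has positive reach. -/
def normalBundle (X : Set (E d)) : Set (E d × E d) :=
  {p | p.1 ∈ frontier X ∧ p.2 ∈ normalCone X p.1 ∧ ‖p.2‖ = 1}

/-- The condition under which `X` admits the normal bundle above: its complement set has positive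
reach and is a Lipschitz domain. -/
def AdmitsNormalBundle (X : Set (E d)) : Prop :=
  0 < reach (closedCompl X) ∧ IsFullyDimensional (closedCompl X)

/-- A pair `(x, n)` of a bundle `N` is regular when `Tan(N, (x, n))` is a vector space of
dimension `d - 1`. -/
def IsRegularPair (N : Set (E d × E d)) (p : E d × E d) : Prop :=
  p ∈ N ∧ ∃ T : Submodule ℝ (E d × E d), (T : Set (E d × E d)) = tangentCone N p ∧
    Module.finrank ℝ T + 1 = d

/-- The tangent space of a bundle at a pair (equal to the tangent cone at regular pairs). -/
def tangentSpace (N : Set (E d × E d)) (p : E d × E d) : Submodule ℝ (E d × E d) :=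
  Submodule.span ℝ (tangentCone N p)

/-! ### Principal curvatures -/

/-- The vector `(b / √(1 + κ²), κ b / √(1 + κ²))`, which is `(0, b)` when `κ = ∞`. -/
def principalVector (κ : WithTop ℝ) (b : E d) : E d × E d :=
  match κ with
  | ⊤ => (0, b)
  | (k : ℝ) => ((1 / Real.sqrt (1 + k ^ 2)) • b, (k / Real.sqrt (1 + k ^ 2)) • b)

/-- `κ` is the family of principal curvatures of the bundle `N` at `(x, n)` (finite or infinite,
with multiplicities) and `b` is a family of corresponding principal directions: the `b i` are
orthogonal to `n`, and the vectors `(b i / √(1 + κ i ²), κ i b i / √(1 + κ i ²))` form an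
orthonormal basis of the tangent space of `N` at `(x, n)`, in the Euclidean space
`ℝ^d × ℝ^d`. -/
structure IsPrincipalCurvatures (N : Set (E d × E d)) (x n : E d)
    (κ : Fin (d - 1) → WithTop ℝ) (b : Fin (d - 1) → E d) : Prop where
  orthogonal : ∀ i, ⟪b i, n⟫ = 0
  orthonormal : Orthonormal ℝ (fun i => WithLp.toLp 2 (principalVector (κ i) (b i)))
  span_eq : (Submodule.span ℝ (Set.range fun i => principalVector (κ i) (b i)) :
    Set (E d × E d)) = tangentCone N (x, n)

/-- The number of infinite members of a family of curvatures. -/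
def numInfinite {m : ℕ} (κ : Fin m → WithTop ℝ) : ℕ := Set.ncard {i | κ i = ⊤}

/-! ### Second fundamental form, critical points, Hessian, index -/

/-- The projection `π₀(T)` of a space of pairs onto the first factor. -/
abbrev firstProj (T : Submodule ℝ (E d × E d)) : Submodule ℝ (E d) :=
  T.map (LinearMap.fst ℝ (E d) (E d))

/-- The first projection, as a linear map from `T` onto `π₀(T)`. -/
def toFirstProj (T : Submodule ℝ (E d × E d)) : T →ₗ[ℝ] firstProj T :=
  (LinearMap.fst ℝ (E d) (E d)).submoduleMap T

theorem exists_lift (T : Submodule ℝ (E d × E d)) :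
    ∃ s : firstProj T →ₗ[ℝ] T, toFirstProj T ∘ₗ s = LinearMap.id :=
  (toFirstProj T).exists_rightInverse_of_surjective
    (LinearMap.range_eq_top.2 ((LinearMap.fst ℝ (E d) (E d)).submoduleMap_surjective T))

/-- A linear choice, for every `u ∈ π₀(T)`, of a pair `(u, v) ∈ T`. -/
def liftPair (T : Submodule ℝ (E d × E d)) : firstProj T →ₗ[ℝ] T := Classical.choose (exists_lift T)

/-- The second fundamental form on `π₀(T)`: its value at `(u, u')` is `⟪u, v'⟫` where
`(u', v') ∈ T`. When `T` is the tangent space at a regular pair, `⟪u, v'⟫` does not depend on the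
choice of `v'`. -/
def secondFundamentalForm (T : Submodule ℝ (E d × E d)) : LinearMap.BilinForm ℝ (firstProj T) :=
  LinearMap.mk₂ ℝ (fun u u' => ⟪(u : E d), (liftPair T u' : E d × E d).2⟫)
    (by intro a b c; simp [inner_add_left]) (by intro c a b; simp [inner_smul_left])
    (by intro a b c; simp [inner_add_right]) (by intro c a b; simp [inner_smul_right])

/-- The values of the second fundamental form do not depend on the chosen pairs as soon as the
defining expression does not. -/
theorem secondFundamentalForm_apply (T : Submodule ℝ (E d × E d))
    (hT : ∀ p ∈ T, ∀ w : E d, ((0 : E d), w) ∈ T → ⟪p.1, w⟫ = 0) (p q : T) :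
    secondFundamentalForm T (toFirstProj T p) (toFirstProj T q) =
      ⟪(p : E d × E d).1, (q : E d × E d).2⟫ := by
  have hl : toFirstProj T (liftPair T (toFirstProj T q)) = toFirstProj T q :=
    LinearMap.congr_fun (Classical.choose_spec (exists_lift T)) (toFirstProj T q)
  have hl' : (liftPair T (toFirstProj T q) : E d × E d).1 = (q : E d × E d).1 :=
    congrArg Subtype.val hl
  have hmem : ((liftPair T (toFirstProj T q) - q : T) : E d × E d) ∈ T := Subtype.property _
  have heq : ((liftPair T (toFirstProj T q) - q : T) : E d × E d) =
      (0, (liftPair T (toFirstProj T q) : E d × E d).2 - (q : E d × E d).2) := by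
    ext1
    · simp [hl']
    · simp
  rw [heq] at hmem
  have h0 := hT p p.2 _ hmem
  rw [inner_sub_right, sub_eq_zero] at h0
  exact h0

/-- `x ∈ X` is a critical point of `f` restricted to `X` when `∇f(x) ∈ - Nor(X, x)`. -/
def IsCriticalPoint (f : E d → ℝ) (X : Set (E d)) (x : E d) : Prop :=
  x ∈ X ∧ -gradient f x ∈ normalCone X x

/-- The unit vector `∇f(x) / ‖∇f(x)‖`. -/
def unitGradient (f : E d → ℝ) (x : E d) : E d := ‖gradient f x‖⁻¹ • gradient f x

/-- The tangent space of `Nor(X)` at `(x, -∇f(x) / ‖∇f(x)‖)`. -/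
def criticalTangentSpace (f : E d → ℝ) (X : Set (E d)) (x : E d) : Submodule ℝ (E d × E d) :=
  tangentSpace (normalBundle X) (x, -unitGradient f x)

/-- The Hessian of `f` restricted to `X` at `x`, a bilinear form on the first projection of the
tangent space of `Nor(X)` at `(x, -∇f(x) / ‖∇f(x)‖)`: the sum of the Hessian of `f` and of
`‖∇f(x)‖` times the second fundamental form. -/
def restrictedHessian (f : E d → ℝ) (X : Set (E d)) (x : E d) :
    LinearMap.BilinForm ℝ (firstProj (criticalTangentSpace f X x)) :=
  (ContinuousLinearMap.toLinearMap₁₂ (fderiv ℝ (fderiv ℝ f) x)).domRestrict₁₂ _ _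
    + ‖gradient f x‖ • secondFundamentalForm (criticalTangentSpace f X x)

/-- The index of a bilinear form: the largest dimension of a subspace on which it is negative
definite. -/
def index {V : Type*} [AddCommGroup V] [Module ℝ V] (B : LinearMap.BilinForm ℝ V) : ℕ :=
  sSup {k | ∃ W : Submodule ℝ V, Module.finrank ℝ W = k ∧ ∀ w ∈ W, w ≠ 0 → B w w < 0}

/-- Non-degenerate critical points of `f` restricted to `X`. -/
structure IsNondegenerateCriticalPoint (f : E d → ℝ) (X : Set (E d)) (x : E d) : Prop where
  isCriticalPoint : IsCriticalPoint f X x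
  gradient_ne_zero : gradient f x ≠ 0
  isRegularPair : IsRegularPair (normalBundle X) (x, -unitGradient f x)
  nondegenerate : (restrictedHessian f X x).Nondegenerate

/-- The translated function `f_r(y) = f(y - r ∇f(x) / ‖∇f(x)‖)`. -/
def translatedFun (f : E d → ℝ) (x : E d) (r : ℝ) : E d → ℝ := fun y => f (y - r • unitGradient f x)

/-- The translated point `x^r = x + r ∇f(x) / ‖∇f(x)‖`. -/
def translatedPoint (f : E d → ℝ) (x : E d) (r : ℝ) : E d := x + r • unitGradient f x

end ComplementaryRegular

end

noncomputable section

namespace ComplementaryRegular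

variable {d : ℕ}

/-! ### Nearest points -/

/-! Write A for `closedCompl X`, ν for the unit gradient at x, g for ‖∇f(x)‖ and H for the Hessian
of f at x. Every normal bundle involved is a copy of Nor(A): the linear involution `offsetMap r`,
(a, n) ↦ (a + r n, -n), exchanges Nor(A) with Nor(X^{-r}) for small r > 0
(`normalBundle_erosion_eq_preimage`) and with Nor(X) for r = 0 (`normalBundle_eq_preimage`). This
rests on the fact that normals of a set of positive reach are the directions along which the
distance grows at unit speed up to the reach. So a single space T, tangent to Nor(A) at (x, ν),
yields all tangent spaces, and all Hessians can be compared on T. As translation changes neither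
gradient nor Hessian of f, the pullback along (u, v) ↦ u + r v is the form H(u + r v, u + r v) - g⟨u
+ r v, v⟩.

For r > 0 this pullback map is injective on T, because the nearest-point map is Lipschitz
(`eq_zero_of_mem_tangentCone`). For r = 0 its kernel consists of the vertical vectors (0, v), whose
dimension is the number of infinite curvatures (`finrank_firstProj_add_numInfinite`). On a vertical
vector the form is r² H(v, v) - r g ‖v‖², negative for small r, so the whole kernel joins the
negative part, while the definite subspaces present at r = 0 persist. Cross terms are controlled by
rescaling the vertical directions by √r (`eventually_offsetForm_neg`).

The rescaling needs T to be isotropic, ⟨u, v'⟩ = ⟨u', v⟩ (`inner_tangent_comm`). At a regular pair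
the nearest-point map is differentiable at x + rν, with derivative u + r v ↦ u on ν^⊥; being the
gradient of (‖y‖² - d_A(y)²)/2, it has a symmetric derivative. Diagonalising that derivative also
produces the principal curvatures. -/

/-- Every point at distance less than `R` from `A` has a unique closest point in `A`. -/
def HasUniqueNearest (A : Set (E d)) (R : ℝ) : Prop :=
  ∀ y : E d, Metric.infDist y A < R → ∃! a, a ∈ A ∧ dist y a = Metric.infDist y A

theorem HasUniqueNearest.nonempty {A : Set (E d)} {R : ℝ} (h : HasUniqueNearest A R)
    (hR : 0 < R) : A.Nonempty := by
  by_contra hA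
  rw [Set.not_nonempty_iff_eq_empty] at hA
  subst hA
  obtain ⟨a, ha, -⟩ := h 0 (by simpa using hR)
  exact ha.1

theorem exists_hasUniqueNearest_of_lt_reach {A : Set (E d)} {r : ℝ} (hr : 0 ≤ r)
    (h : ENNReal.ofReal r < reach A) : ∃ R, r < R ∧ HasUniqueNearest A R := by
  obtain ⟨t, ⟨s, rfl, hs⟩, hrt⟩ := lt_sSup_iff.1 h
  refine ⟨s, ?_, hs⟩
  rw [ENNReal.ofReal_lt_coe_iff hr] at hrt
  exact hrt

theorem HasUniqueNearest.reach_pos {A : Set (E d)} {R : ℝ} (hR : 0 < R)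
    (h : HasUniqueNearest A R) : 0 < reach A := by
  refine lt_of_lt_of_le (b := ((R.toNNReal : ℝ≥0) : ℝ≥0∞)) (by simpa using hR)
    (le_sSup ⟨R.toNNReal, rfl, fun y hy => h y ?_⟩)
  rwa [Real.coe_toNNReal _ hR.le] at hy

open Classical in
/-- A closest point of `A` to `y`. -/
def nearest (A : Set (E d)) (y : E d) : E d :=
  if h : ∃ a ∈ A, Metric.infDist y A = dist y a then h.choose else y

section
variable {A : Set (E d)} (hA : IsClosed A) (hne : A.Nonempty)
include hA hne

theorem nearest_spec (y : E d) : nearest A y ∈ A ∧ Metric.infDist y A = dist y (nearest A y) := by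
  have h := hA.exists_infDist_eq_dist hne y
  rw [nearest, dif_pos h]
  exact h.choose_spec

theorem nearest_mem (y : E d) : nearest A y ∈ A := (nearest_spec hA hne y).1

theorem norm_sub_nearest (y : E d) : ‖y - nearest A y‖ = Metric.infDist y A := by
  rw [(nearest_spec hA hne y).2, dist_eq_norm]

end

theorem infDist_le_norm_sub {A : Set (E d)} {a : E d} (y : E d) (ha : a ∈ A) :
    Metric.infDist y A ≤ ‖y - a‖ := by
  rw [← dist_eq_norm]; exact Metric.infDist_le_dist_of_mem ha

theorem infDist_le_add_norm_sub (A : Set (E d)) (y z : E d) :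
    Metric.infDist y A ≤ Metric.infDist z A + ‖y - z‖ := by
  rw [← dist_eq_norm]; exact Metric.infDist_le_infDist_add_dist

section
variable {A : Set (E d)} {R : ℝ} (hA : IsClosed A) (hR : 0 < R) (hU : HasUniqueNearest A R)
include hA hR hU

theorem eq_nearest {y a : E d} (hy : Metric.infDist y A < R) (ha : a ∈ A)
    (h : ‖y - a‖ ≤ Metric.infDist y A) : a = nearest A y := by
  have hne := hU.nonempty hR
  refine (hU y hy).unique ⟨ha, ?_⟩ ⟨nearest_mem hA hne y, ?_⟩
  · rw [dist_eq_norm]; exact le_antisymm h (infDist_le_norm_sub y ha)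
  · rw [dist_eq_norm, norm_sub_nearest hA hne]

/-- Nearest points of points near y stay in a compact ball, and each of their cluster points is a
nearest point of y, hence the unique one. -/
theorem tendsto_nearest {y : E d} (hy : Metric.infDist y A < R) :
    Tendsto (nearest A) (𝓝 y) (𝓝 (nearest A y)) := by
  have hne := hU.nonempty hR
  have key : ∀ ε > 0, ∀ᶠ z in 𝓝 y,
      nearest A z ∈ A ∩ Metric.closedBall y (Metric.infDist y A + ε) := by
    intro ε hε
    filter_upwards [Metric.ball_mem_nhds y (half_pos hε)] with z hz
    refine ⟨nearest_mem hA hne z, ?_⟩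
    rw [Metric.mem_ball] at hz
    rw [Metric.mem_closedBall, dist_comm]
    have h1 := dist_triangle y z (nearest A z)
    rw [← (nearest_spec hA hne z).2, dist_comm y z] at h1
    have h2 : Metric.infDist z A ≤ Metric.infDist y A + dist z y :=
      Metric.infDist_le_infDist_add_dist
    linarith
  refine (isCompact_closedBall y (Metric.infDist y A + 1)).tendsto_nhds_of_unique_mapClusterPt
    ((key 1 one_pos).mono fun z hz => hz.2) fun a _ ha => ?_
  have h : ∀ ε > 0, a ∈ A ∩ Metric.closedBall y (Metric.infDist y A + ε) := fun ε hε =>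
    (hA.inter Metric.isClosed_closedBall).mem_of_mapClusterPt ha (key ε hε)
  refine eq_nearest hA hR hU hy (h 1 one_pos).1 (le_of_forall_pos_le_add fun ε hε => ?_)
  have := (h ε hε).2
  rwa [Metric.mem_closedBall, dist_comm, dist_eq_norm] at this

/-- The distance function has slope one in the direction pointing away from the nearest point. -/
theorem exists_infDist_add_smul_gt {z : E d} (h0 : 0 < Metric.infDist z A)
    (hz : Metric.infDist z A < R) {l δ : ℝ} (hl : l < 1) (hδ : 0 < δ) :
    ∃ w : E d, ‖w‖ ≤ 1 ∧ ∃ h, 0 < h ∧ h < δ ∧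
      Metric.infDist z A + l * h < Metric.infDist (z + h • w) A := by
  have hne := hU.nonempty hR
  set p := nearest A z with hp
  have hzp : ‖z - p‖ = Metric.infDist z A := norm_sub_nearest hA hne z
  set w : E d := ‖z - p‖⁻¹ • (z - p) with hw
  have hpos : 0 < ‖z - p‖ := by rw [hzp]; exact h0
  have hw1 : ‖w‖ = 1 := by rw [hw, norm_smul, norm_inv, norm_norm, inv_mul_cancel₀ hpos.ne']
  have hq : Tendsto (fun h : ℝ => nearest A (z + h • w)) (𝓝 0) (𝓝 p) := by
    have h1 : Tendsto (fun h : ℝ => z + h • w) (𝓝 0) (𝓝 z) := by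
      have : Continuous fun h : ℝ => z + h • w := by fun_prop
      simpa using this.tendsto 0
    exact (tendsto_nearest hA hR hU hz).comp h1
  -- The nearest point q of z + h w tends to p, so the cosine of the angle between w and z - q tends
  -- to 1. Cauchy–Schwarz for z - q and z + h w - q turns this cosine into a lower bound for the
  -- slope.
  have hlim : Tendsto (fun h : ℝ => ⟪w, z - nearest A (z + h • w)⟫ /
      ‖z - nearest A (z + h • w)‖) (𝓝 0) (𝓝 1) := by
    have h1 : Tendsto (fun h : ℝ => z - nearest A (z + h • w)) (𝓝 0) (𝓝 (z - p)) :=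
      tendsto_const_nhds.sub hq
    have h2 := (Tendsto.inner (tendsto_const_nhds (x := w)) h1).div h1.norm hpos.ne'
    have h3 : ⟪w, z - p⟫ / ‖z - p‖ = 1 := by
      rw [hw, real_inner_smul_left, real_inner_self_eq_norm_sq]
      field_simp
    rwa [h3] at h2
  have hev := (hlim.eventually (lt_mem_nhds hl)).filter_mono (nhdsWithin_le_nhds (s := Set.Ioi 0))
  obtain ⟨h, hh, hh0, hhδ⟩ := (hev.and (Ioo_mem_nhdsGT hδ)).exists
  refine ⟨w, hw1.le, h, hh0, hhδ, ?_⟩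
  set q := nearest A (z + h • w) with hqdef
  have hqA : q ∈ A := nearest_mem hA hne _
  have hdq : Metric.infDist (z + h • w) A = ‖z + h • w - q‖ := (norm_sub_nearest hA hne _).symm
  have hzq : Metric.infDist z A ≤ ‖z - q‖ := infDist_le_norm_sub z hqA
  have hzq0 : 0 < ‖z - q‖ := h0.trans_le hzq
  rw [lt_div_iff₀ hzq0] at hh
  have hcs : ⟪z - q, z + h • w - q⟫ ≤ ‖z - q‖ * ‖z + h • w - q‖ := real_inner_le_norm _ _
  have hexp : ⟪z - q, z + h • w - q⟫ = ‖z - q‖ ^ 2 + h * ⟪w, z - q⟫ := by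
    rw [show z + h • w - q = (z - q) + h • w by abel, inner_add_right, real_inner_smul_right,
      real_inner_self_eq_norm_sq, real_inner_comm]
  rw [hexp] at hcs
  rw [hdq]
  have : ‖z - q‖ * (‖z - q‖ + l * h) < ‖z - q‖ * ‖z + h • w - q‖ := by nlinarith
  have := lt_of_mul_lt_mul_left this hzq0.le
  linarith

/-- Normals extend: moving away from the nearest point increases the distance at unit speed. -/
theorem infDist_add_smul_of_infDist_eq {a n : E d} (ha : a ∈ A) (hn : ‖n‖ = 1) {t s : ℝ}
    (ht : 0 < t) (hat : Metric.infDist (a + t • n) A = t) (hts : t < s) (hs : s < R) :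
    Metric.infDist (a + s • n) A = s := by
  set y := a + t • n with hy
  set ε := s - t with hε
  have hε0 : 0 < ε := by rw [hε]; linarith
  obtain ⟨z, hzB, hzmax⟩ := (isCompact_closedBall y ε).exists_isMaxOn
    ⟨y, Metric.mem_closedBall_self hε0.le⟩ (Metric.continuous_infDist_pt A).continuousOn
  have hzB' : ‖z - y‖ ≤ ε := by rwa [Metric.mem_closedBall, dist_eq_norm] at hzB
  -- A penalisation argument: if the maximum M of the distance on the ball were below s, a slope l <
  -- 1 with l ε > M - t would force a maximiser of the distance minus l‖z - y‖ into the open ball,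
  -- where a direction of slope greater than l contradicts maximality.
  have hMs : s ≤ Metric.infDist z A := by
    by_contra! hlt
    set M := Metric.infDist z A with hM
    have htM : t ≤ M := by
      rw [← hat]; exact hzmax (Metric.mem_closedBall_self hε0.le)
    obtain ⟨l, hl, hl1⟩ : ∃ l, (M - t) / ε < l ∧ l < 1 :=
      exists_between (by rw [div_lt_one hε0, hε]; linarith)
    have hl0 : 0 < l := lt_of_le_of_lt (div_nonneg (by linarith) hε0.le) hl
    rw [div_lt_iff₀ hε0] at hl
    obtain ⟨z', hz'B, hz'max⟩ := (isCompact_closedBall y ε).exists_isMaxOn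
      (f := fun z => Metric.infDist z A - l * ‖z - y‖)
      ⟨y, Metric.mem_closedBall_self hε0.le⟩
      (((Metric.continuous_infDist_pt A).sub (by fun_prop)).continuousOn)
    have h1 : t ≤ Metric.infDist z' A - l * ‖z' - y‖ := by
      have := hz'max (Metric.mem_closedBall_self hε0.le)
      simpa [hat] using this
    have h2 : Metric.infDist z' A ≤ M := hzmax hz'B
    rw [Metric.mem_closedBall, dist_eq_norm] at hz'B
    have h3 : ‖z' - y‖ < ε := by
      refine lt_of_le_of_ne hz'B fun h => ?_
      rw [h] at h1; linarith
    have h4 : 0 ≤ l * ‖z' - y‖ := by positivity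
    obtain ⟨w, hw, h, hh0, hhε, hgt⟩ := exists_infDist_add_smul_gt hA hR hU (z := z')
      (by linarith) (by linarith) hl1 (sub_pos.2 h3)
    have hn' : ‖z' + h • w - y‖ ≤ ‖z' - y‖ + h := by
      rw [show z' + h • w - y = (z' - y) + h • w by abel]
      refine (norm_add_le _ _).trans ?_
      rw [norm_smul, Real.norm_of_nonneg hh0.le]
      nlinarith
    have h5 : Metric.infDist (z' + h • w) A - l * ‖z' + h • w - y‖ ≤
        Metric.infDist z' A - l * ‖z' - y‖ :=
      hz'max (by rw [Metric.mem_closedBall, dist_eq_norm]; linarith)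
    nlinarith
  -- Now ‖z - a‖ ≥ s = t + ε while ‖z - y‖ ≤ ε and ‖y - a‖ = t: equality in the triangle inequality
  -- forces z = a + s n.
  have hza : s ≤ ‖z - a‖ := hMs.trans (infDist_le_norm_sub z ha)
  have hexp : ‖z - a‖ ^ 2 = ‖z - y‖ ^ 2 + 2 * (t * ⟪z - y, n⟫) + t ^ 2 := by
    rw [show z - a = (z - y) + t • n by rw [hy]; abel, norm_add_sq_real, real_inner_smul_right,
      norm_smul, hn, mul_one, Real.norm_eq_abs, sq_abs]
  have hin : ε ≤ ⟪z - y, n⟫ := by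
    have h1 : s ^ 2 ≤ ‖z - a‖ ^ 2 := pow_le_pow_left₀ (by linarith) hza 2
    have h2 : ‖z - y‖ ^ 2 ≤ ε ^ 2 := pow_le_pow_left₀ (norm_nonneg _) hzB' 2
    have h3 : t * ε ≤ t * ⟪z - y, n⟫ := by nlinarith
    exact le_of_mul_le_mul_left h3 ht
  have hzero : ‖z - y - ε • n‖ ^ 2 ≤ 0 := by
    rw [norm_sub_sq_real, real_inner_smul_right, norm_smul, hn, mul_one, Real.norm_eq_abs, sq_abs]
    have h2 : ‖z - y‖ ^ 2 ≤ ε ^ 2 := pow_le_pow_left₀ (norm_nonneg _) hzB' 2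
    nlinarith
  have hz0 : z - y - ε • n = 0 := norm_eq_zero.1 (by nlinarith [norm_nonneg (z - y - ε • n)])
  have hzeq : z = a + s • n := by
    rw [sub_sub, sub_eq_zero] at hz0
    rw [hz0, hy, hε, add_assoc, ← add_smul]; congr 2; ring
  rw [← hzeq]
  refine le_antisymm ?_ hMs
  refine (infDist_le_norm_sub z ha).trans ?_
  rw [hzeq, add_sub_cancel_left, norm_smul, hn, mul_one, Real.norm_of_nonneg (by linarith)]

end

theorem infDist_add_smul_of_le {A : Set (E d)} {a n : E d} (ha : a ∈ A) (hn : ‖n‖ = 1) {t s : ℝ}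
    (hat : Metric.infDist (a + t • n) A = t) (hs0 : 0 ≤ s) (hst : s ≤ t) :
    Metric.infDist (a + s • n) A = s := by
  refine le_antisymm ?_ ?_
  · refine (infDist_le_norm_sub _ ha).trans ?_
    rw [add_sub_cancel_left, norm_smul, hn, mul_one, Real.norm_of_nonneg hs0]
  · have h := infDist_le_add_norm_sub A (a + t • n) (a + s • n)
    rw [hat, add_sub_add_left_eq_sub, ← sub_smul, norm_smul, hn, mul_one,
      Real.norm_of_nonneg (by linarith)] at h
    linarith

/-- The open ball of radius s about a + s n contains no point of A; expanding ‖a + s n - b‖ ≥ s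
gives Federer's inequality. -/
theorem inner_le_of_infDist_eq {A : Set (E d)} {a n b : E d} (hb : b ∈ A) (hn : ‖n‖ = 1)
    {s : ℝ} (hs : 0 < s) (has : Metric.infDist (a + s • n) A = s) :
    2 * s * ⟪n, b - a⟫ ≤ ‖b - a‖ ^ 2 := by
  have h := infDist_le_norm_sub (a + s • n) hb
  rw [has, show a + s • n - b = s • n - (b - a) by abel] at h
  have h2 := pow_le_pow_left₀ hs.le h 2
  rw [norm_sub_sq_real, real_inner_smul_left, norm_smul, hn, mul_one, Real.norm_eq_abs,
    sq_abs] at h2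
  linarith

/-! ### Normals of sets of positive reach -/

/-- Polar vectors of the tangent cone are normals along which the distance grows at unit speed. -/
theorem infDist_add_smul_of_mem_polarCone {A : Set (E d)} {R : ℝ} (hA : IsClosed A) (hR : 0 < R)
    (hU : HasUniqueNearest A R) {a n : E d} (ha : a ∈ A) (hn : ‖n‖ = 1)
    (hpol : n ∈ polarCone (tangentCone A a)) {s : ℝ} (hs0 : 0 ≤ s) (hs : s < R) :
    Metric.infDist (a + s • n) A = s := by
  have hne := hU.nonempty hR
  rcases hs0.eq_or_lt with rfl | hs0
  · simpa using Metric.infDist_zero_of_mem ha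
  set t : ℕ → ℝ := fun k => 1 / ((k : ℝ) + 1) with ht
  have ht0 : ∀ k, 0 < t k := fun k => by rw [ht]; positivity
  have htlim : Tendsto t atTop (𝓝 0) := tendsto_one_div_add_atTop_nhds_zero_nat
  set p : ℕ → E d := fun k => nearest A (a + t k • n) with hp
  set D : ℕ → ℝ := fun k => Metric.infDist (a + t k • n) A with hD
  have hDp : ∀ k, ‖a + t k • n - p k‖ = D k := fun k => norm_sub_nearest hA hne _
  have hDt : ∀ k, D k ≤ t k := fun k => by
    refine (infDist_le_norm_sub _ ha).trans ?_
    rw [add_sub_cancel_left, norm_smul, hn, mul_one, Real.norm_of_nonneg (ht0 k).le]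
  -- The rescaled displacements of the nearest points of a + t n are bounded, and any limit w of
  -- them is tangent to A at a.
  set q : ℕ → E d := fun k => (t k)⁻¹ • (p k - a) with hq
  have hnq : ∀ k, n - q k = (t k)⁻¹ • (a + t k • n - p k) := fun k => by
    rw [hq, show a + t k • n - p k = t k • n - (p k - a) by abel, smul_sub, smul_smul,
      inv_mul_cancel₀ (ht0 k).ne', one_smul]
  have hnq1 : ∀ k, ‖n - q k‖ ≤ 1 := fun k => by
    rw [hnq, norm_smul, hDp, norm_inv, Real.norm_of_nonneg (ht0 k).le, inv_mul_le_one₀ (ht0 k)]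
    exact hDt k
  have hqB : ∀ k, q k ∈ Metric.closedBall n 1 := fun k => by
    rw [Metric.mem_closedBall, dist_comm, dist_eq_norm]; exact hnq1 k
  obtain ⟨w, hw, φ, hφ, hlim⟩ := (isCompact_closedBall n (1 : ℝ)).tendsto_subseq hqB
  have htφ : Tendsto (fun k => t (φ k)) atTop (𝓝 0) := htlim.comp hφ.tendsto_atTop
  have hpa : Tendsto (fun k => p (φ k) - a) atTop (𝓝 0) := by
    have h := htφ.smul hlim
    rw [zero_smul] at h
    refine h.congr fun k => ?_
    simp only [hq, Function.comp, smul_smul]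
    rw [mul_inv_cancel₀ (ht0 _).ne', one_smul]
  have hwT : w ∈ tangentCone A a := by
    refine mem_tangentConeAt_of_seq atTop (fun k => ((t (φ k))⁻¹).toNNReal)
      (fun k => p (φ k) - a) hpa (Eventually.of_forall fun k => ?_) ?_
    · rw [add_sub_cancel]; exact nearest_mem hA hne _
    · refine hlim.congr fun k => ?_
      rw [NNReal.smul_def, Real.coe_toNNReal _ (inv_nonneg.2 (ht0 _).le)]
      rfl
  -- From ‖n - w‖ ≤ 1 = ‖n‖ one gets ‖w‖² ≤ 2⟨n, w⟩, which is nonpositive by polarity.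
  have hw0 : w = 0 := by
    have h1 : ⟪n, w⟫ ≤ 0 := hpol w hwT
    rw [Metric.mem_closedBall, dist_comm, dist_eq_norm] at hw
    have h2 := pow_le_pow_left₀ (norm_nonneg _) hw 2
    rw [norm_sub_sq_real, hn] at h2
    exact norm_eq_zero.1 (by nlinarith [norm_nonneg w])
  rw [hw0] at hlim
  have hnlim : Tendsto (fun k => n - q (φ k)) atTop (𝓝 n) := by
    simpa using hlim.const_sub n
  have hne0 : ∀ᶠ k in atTop, n - q (φ k) ≠ 0 :=
    hnlim.eventually_ne (by rw [← norm_pos_iff, hn]; exact one_pos)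
  -- These are unit normals at the nearest points along which the distance already grows at unit
  -- speed, so they extend up to length s. They converge to n, and the identity passes to the limit.
  set m : ℕ → E d := fun k => ‖n - q (φ k)‖⁻¹ • (n - q (φ k)) with hm
  have hmlim : Tendsto m atTop (𝓝 n) := by
    have := (hnlim.norm.inv₀ (by rw [hn]; exact one_ne_zero)).smul hnlim
    simpa [hn] using this
  have hplim : Tendsto (fun k => p (φ k)) atTop (𝓝 a) := by
    simpa using hpa.add_const a
  have hlim2 : Tendsto (fun k => Metric.infDist (p (φ k) + s • m k) A) atTop
      (𝓝 (Metric.infDist (a + s • n) A)) :=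
    ((Metric.continuous_infDist_pt A).tendsto _).comp (hplim.add (hmlim.const_smul s))
  refine tendsto_nhds_unique hlim2 (tendsto_const_nhds.congr' ?_)
  filter_upwards [hne0, htφ.eventually_lt_const hs0] with k hk0 hks
  have hm1 : ‖m k‖ = 1 := by
    rw [hm, norm_smul, norm_inv, norm_norm, inv_mul_cancel₀ (norm_ne_zero_iff.2 hk0)]
  have hDpos : 0 < D (φ k) := by
    rw [← hDp]
    refine norm_pos_iff.2 fun h => hk0 ?_
    rw [hnq, h, smul_zero]
  have hpm : p (φ k) + D (φ k) • m k = a + t (φ k) • n := by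
    have h1 : D (φ k) • m k = a + t (φ k) • n - p (φ k) := by
      rw [hm]
      simp only
      rw [hnq, norm_smul, hDp, smul_smul, smul_smul, norm_inv, Real.norm_of_nonneg (ht0 _).le]
      have := (ht0 (φ k)).ne'
      rw [show D (φ k) * ((t (φ k))⁻¹ * D (φ k))⁻¹ * (t (φ k))⁻¹ = 1 by field_simp, one_smul]
    rw [h1, add_sub_cancel]
  exact (infDist_add_smul_of_infDist_eq hA hR hU (nearest_mem hA hne _) hm1 hDpos
    (by rw [hpm]) ((hDt _).trans_lt hks) hs).symm

/-- Directions along which the distance grows at unit speed are polar to the tangent cone. -/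
theorem mem_polarCone_of_infDist_eq {A : Set (E d)} {a n : E d} (hn : ‖n‖ = 1) {s : ℝ}
    (hs : 0 < s) (has : Metric.infDist (a + s • n) A = s) : n ∈ polarCone (tangentCone A a) := by
  intro b hb
  obtain ⟨α, l, hl, c, v, hv0, hvA, hcv⟩ := exists_fun_of_mem_tangentConeAt hb
  have h1 : Tendsto (fun i => ⟪n, c i • v i⟫) l (𝓝 ⟪n, b⟫) := tendsto_const_nhds.inner hcv
  have h2 : Tendsto (fun i => ‖c i • v i‖ * ‖v i‖ / (2 * s)) l (𝓝 0) := by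
    simpa using (hcv.norm.mul hv0.norm).div_const (2 * s)
  refine le_of_tendsto_of_tendsto h1 h2 ?_
  filter_upwards [hvA] with i hi
  have h := inner_le_of_infDist_eq hi hn hs has
  rw [add_sub_cancel_left] at h
  rw [NNReal.smul_def, real_inner_smul_right, norm_smul, Real.norm_of_nonneg (c i).coe_nonneg,
    le_div_iff₀ (by positivity)]
  nlinarith [mul_le_mul_of_nonneg_left h (c i).coe_nonneg]

theorem mem_frontier_of_infDist_eq {A : Set (E d)} {a n : E d} (ha : a ∈ A) (hn : ‖n‖ = 1) {s : ℝ}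
    (hs : 0 < s) (has : Metric.infDist (a + s • n) A = s) : a ∈ frontier A := by
  refine ⟨subset_closure ha, fun hint => ?_⟩
  obtain ⟨ε, hε, hball⟩ := Metric.mem_nhds_iff.1 (mem_interior_iff_mem_nhds.1 hint)
  set t := min (ε / 2) s with ht
  have ht0 : 0 < t := lt_min (half_pos hε) hs
  have h1 := infDist_add_smul_of_le ha hn has ht0.le (min_le_right _ _)
  have h2 : a + t • n ∈ A := hball (by
    rw [Metric.mem_ball, dist_eq_norm, add_sub_cancel_left, norm_smul, hn, mul_one,
      Real.norm_of_nonneg ht0.le]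
    linarith [min_le_left (ε / 2) s])
  rw [Metric.infDist_zero_of_mem h2] at h1
  exact ht0.ne h1

theorem mem_normalBundleOfReach_of_infDist_eq {A : Set (E d)} {a n : E d} (ha : a ∈ A)
    (hn : ‖n‖ = 1) {s : ℝ} (hs : 0 < s) (has : Metric.infDist (a + s • n) A = s) :
    (a, n) ∈ normalBundleOfReach A :=
  ⟨mem_frontier_of_infDist_eq ha hn hs has, mem_polarCone_of_infDist_eq hn hs has, hn⟩

section
variable {A : Set (E d)} {R : ℝ} (hA : IsClosed A) (hR : 0 < R) (hU : HasUniqueNearest A R)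
include hA hR hU

theorem infDist_add_smul_of_mem_normalBundle {p : E d × E d} (hp : p ∈ normalBundleOfReach A)
    {s : ℝ} (hs0 : 0 ≤ s) (hs : s < R) : Metric.infDist (p.1 + s • p.2) A = s :=
  infDist_add_smul_of_mem_polarCone hA hR hU (hA.frontier_subset hp.1) hp.2.2 hp.2.1 hs0 hs

theorem nearest_add_smul_of_mem_normalBundle {p : E d × E d} (hp : p ∈ normalBundleOfReach A)
    {s : ℝ} (hs0 : 0 ≤ s) (hs : s < R) : nearest A (p.1 + s • p.2) = p.1 := by
  have h := infDist_add_smul_of_mem_normalBundle hA hR hU hp hs0 hs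
  refine (eq_nearest hA hR hU (h.trans_lt hs) (hA.frontier_subset hp.1) ?_).symm
  rw [h, add_sub_cancel_left, norm_smul, hp.2.2, mul_one, Real.norm_of_nonneg hs0]

/-- The unit normal at the nearest point of a point `y` outside of `A`. -/
theorem mem_normalBundle_nearest {y : E d} (h0 : 0 < Metric.infDist y A) :
    (nearest A y, (Metric.infDist y A)⁻¹ • (y - nearest A y)) ∈ normalBundleOfReach A := by
  have hne := hU.nonempty hR
  refine mem_normalBundleOfReach_of_infDist_eq (nearest_mem hA hne y) ?_ h0 ?_
  · rw [norm_smul, norm_sub_nearest hA hne, norm_inv, Real.norm_of_nonneg h0.le,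
      inv_mul_cancel₀ h0.ne']
  · rw [smul_smul, mul_inv_cancel₀ h0.ne', one_smul, add_sub_cancel]

/-- The unit normal at the nearest point extends to every length S < R, so Federer's inequality
holds with S. Multiplying by the distance makes the bound valid for y in A as well. -/
theorem inner_sub_nearest_le {y b : E d} (hb : b ∈ A) {S : ℝ} (hS0 : 0 < S) (hS : S < R) :
    2 * S * ⟪y - nearest A y, b - nearest A y⟫ ≤ Metric.infDist y A * ‖b - nearest A y‖ ^ 2 := by
  have hne := hU.nonempty hR
  rcases (Metric.infDist_nonneg (x := y) (s := A)).eq_or_lt with h0 | h0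
  · have : y - nearest A y = 0 := by rw [← norm_eq_zero, norm_sub_nearest hA hne, ← h0]
    rw [this, ← h0]; simp
  · have hp := mem_normalBundle_nearest hA hR hU h0
    have h := inner_le_of_infDist_eq hb hp.2.2 hS0
      (infDist_add_smul_of_mem_normalBundle hA hR hU hp hS0.le hS)
    simp only [real_inner_smul_left] at h
    have h2 := mul_le_mul_of_nonneg_left h h0.le
    calc _ = Metric.infDist y A * (2 * S * ((Metric.infDist y A)⁻¹ *
          ⟪y - nearest A y, b - nearest A y⟫)) := by field_simp
      _ ≤ _ := h2

/-- Add the inequalities of `inner_sub_nearest_le` at y and z, each tested on the other nearest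
point, and apply Cauchy–Schwarz. -/
theorem norm_nearest_sub_le {r S : ℝ} (hrS : r < S) (hS0 : 0 < S) (hS : S < R) {y z : E d}
    (hy : Metric.infDist y A ≤ r) (hz : Metric.infDist z A ≤ r) :
    ‖nearest A y - nearest A z‖ ≤ S / (S - r) * ‖y - z‖ := by
  have hne := hU.nonempty hR
  have h1 := inner_sub_nearest_le hA hR hU (y := y) (nearest_mem hA hne z) hS0 hS
  have h2 := inner_sub_nearest_le hA hR hU (y := z) (nearest_mem hA hne y) hS0 hS
  set p := nearest A y
  set q := nearest A z
  rw [← neg_sub p q, inner_neg_right, norm_neg] at h1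
  have h3 : ⟪y - p, p - q⟫ - ⟪z - q, p - q⟫ = ⟪y - z, p - q⟫ - ‖p - q‖ ^ 2 := by
    rw [← inner_sub_left, ← real_inner_self_eq_norm_sq, ← inner_sub_left]; congr 1; abel
  have h4 : ⟪y - z, p - q⟫ ≤ ‖y - z‖ * ‖p - q‖ := real_inner_le_norm _ _
  have h5 : Metric.infDist y A * ‖p - q‖ ^ 2 ≤ r * ‖p - q‖ ^ 2 := by gcongr
  have h6 : Metric.infDist z A * ‖p - q‖ ^ 2 ≤ r * ‖p - q‖ ^ 2 := by gcongr
  have h7 : (S - r) * ‖p - q‖ ^ 2 ≤ S * (‖y - z‖ * ‖p - q‖) := by nlinarith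
  rw [div_mul_eq_mul_div, le_div_iff₀ (by linarith)]
  rcases (norm_nonneg (p - q)).eq_or_lt with h0 | h0
  · rw [← h0, zero_mul]; positivity
  · exact le_of_mul_le_mul_right (by nlinarith) h0

end

/-! ### Offsets of sets of positive reach -/

section
variable {A : Set (E d)} (hA : IsClosed A) (hne : A.Nonempty)
include hA hne

theorem closedCompl_erosion_eq {X : Set (E d)} (hXA : closedCompl X = A) {r : ℝ} (hr : 0 < r) :
    closedCompl (erosion X r) = {y | Metric.infDist y A ≤ r} := by
  have hcompl : (erosion X r)ᶜ = {y | Metric.infDist y A < r} := by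
    ext y; simp [erosion, hXA]
  rw [closedCompl, hcompl]
  refine Set.Subset.antisymm (closure_lt_subset_le (Metric.continuous_infDist_pt A)
    continuous_const) fun y hy => ?_
  rcases lt_or_eq_of_le (show Metric.infDist y A ≤ r from hy) with h | h
  · exact subset_closure h
  have hp := norm_sub_nearest hA hne y
  set p := nearest A y
  -- A point at distance exactly r is approached along the segment from its nearest point, where the
  -- distance is strictly smaller.
  have hlim : Tendsto (fun t : ℝ => p + t • (y - p)) (𝓝[<] 1) (𝓝 y) := by
    have : Continuous fun t : ℝ => p + t • (y - p) := by fun_prop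
    simpa using (this.tendsto 1).mono_left nhdsWithin_le_nhds
  refine mem_closure_of_tendsto hlim ?_
  filter_upwards [Ioo_mem_nhdsLT (zero_lt_one (α := ℝ))] with t ht
  show Metric.infDist _ A < r
  refine (infDist_le_norm_sub _ (nearest_mem hA hne y)).trans_lt ?_
  rw [add_sub_cancel_left, norm_smul, hp, h, Real.norm_of_nonneg ht.1.le]
  nlinarith [ht.2]

theorem infDist_offset {r : ℝ} (hr : 0 ≤ r) {y : E d} (hy : r ≤ Metric.infDist y A) :
    Metric.infDist y {y | Metric.infDist y A ≤ r} = Metric.infDist y A - r := by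
  obtain ⟨a, ha⟩ := hne
  have hne' : {y | Metric.infDist y A ≤ r}.Nonempty :=
    ⟨a, by simpa [Metric.infDist_zero_of_mem ha] using hr⟩
  refine le_antisymm ?_ ?_
  · have hp := norm_sub_nearest hA ⟨a, ha⟩ y
    have hpA := nearest_mem hA ⟨a, ha⟩ y
    set p := nearest A y
    rcases hr.eq_or_lt with rfl | hr0
    · have : p ∈ {y | Metric.infDist y A ≤ 0} := by simp [Metric.infDist_zero_of_mem hpA]
      simpa [hp] using infDist_le_norm_sub y this
    have hpos : 0 < Metric.infDist y A := hr0.trans_le hy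
    set D := Metric.infDist y A with hD
    have hq : p + (r / D) • (y - p) ∈ {y | Metric.infDist y A ≤ r} := by
      refine (infDist_le_norm_sub _ hpA).trans ?_
      rw [add_sub_cancel_left, norm_smul, hp, Real.norm_of_nonneg (by positivity),
        div_mul_cancel₀ _ hpos.ne']
    refine (infDist_le_norm_sub y hq).trans ?_
    rw [show y - (p + (r / D) • (y - p)) = (1 - r / D) • (y - p) by rw [sub_smul, one_smul]; abel,
      norm_smul, hp, Real.norm_of_nonneg (by rw [sub_nonneg, div_le_one hpos]; exact hy), sub_mul,
      div_mul_cancel₀ _ hpos.ne', one_mul]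
  · refine (Metric.le_infDist hne').2 fun z hz => ?_
    have := infDist_le_add_norm_sub A y z
    rw [dist_eq_norm]
    have hz' : Metric.infDist z A ≤ r := hz
    linarith

end

/-- Going from y through a nearest point q of the offset to A costs at most d_A(y), so q has the
same nearest point in A as y, and q is the point of that segment at distance r from A. -/
theorem hasUniqueNearest_offset {A : Set (E d)} {R : ℝ} (hA : IsClosed A) (hR : 0 < R)
    (hU : HasUniqueNearest A R) {r : ℝ} (hr : 0 < r) :
    HasUniqueNearest {y | Metric.infDist y A ≤ r} (R - r) := by
  have hne := hU.nonempty hR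
  intro y hy
  set B := {y : E d | Metric.infDist y A ≤ r} with hB
  have hBc : IsClosed B := isClosed_le (Metric.continuous_infDist_pt A) continuous_const
  rcases le_or_gt (Metric.infDist y A) r with h | h
  · have hyB : y ∈ B := h
    have h0 : Metric.infDist y B = 0 := Metric.infDist_zero_of_mem hyB
    refine ⟨y, ⟨hyB, by rw [h0, dist_self]⟩, fun z hz => ?_⟩
    rw [h0] at hz
    exact (dist_eq_zero.1 hz.2).symm
  have hBne : B.Nonempty := by
    obtain ⟨a, ha⟩ := hne
    exact ⟨a, by simpa [hB, Metric.infDist_zero_of_mem ha] using hr.le⟩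
  have hyB := infDist_offset hA hne hr.le h.le
  have hyR : Metric.infDist y A < R := by rw [hyB] at hy; linarith
  have hp := norm_sub_nearest hA hne y
  set p := nearest A y with hpdef
  set D := Metric.infDist y A with hD
  have hDpos : 0 < D := hr.trans h
  have key : ∀ q, q ∈ B ∧ dist y q = Metric.infDist y B → q = p + (r / D) • (y - p) := by
    rintro q ⟨hqB, hq⟩
    have hq' : ‖y - q‖ = D - r := by rw [← dist_eq_norm, hq, hyB]
    have hqr : Metric.infDist q A ≤ r := hqB
    have hq1 := norm_sub_nearest hA hne q
    have hpq : nearest A q = p := by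
      refine eq_nearest hA hR hU hyR (nearest_mem hA hne q) ?_
      calc ‖y - nearest A q‖ ≤ ‖y - q‖ + ‖q - nearest A q‖ := norm_sub_le_norm_sub_add_norm_sub _ _ _
        _ ≤ D := by linarith
    rw [hpq] at hq1
    have hqr' : ‖q - p‖ ≤ r := by rw [hq1]; exact hqr
    have h1 : ‖y - q‖ ^ 2 = D ^ 2 - 2 * ⟪y - p, q - p⟫ + ‖q - p‖ ^ 2 := by
      rw [← hp, ← norm_sub_sq_real]; congr 2; abel
    have h3 : ⟪q - p, y - p⟫ = ⟪y - p, q - p⟫ := real_inner_comm _ _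
    have h4 : D ≤ ‖y - q‖ + ‖q - p‖ := by
      rw [← hp]; exact norm_sub_le_norm_sub_add_norm_sub _ _ _
    have h5 : ‖q - p‖ = r := le_antisymm hqr' (by linarith)
    have h6 : ⟪y - p, q - p⟫ = D * r := by rw [hq', h5] at h1; nlinarith
    have h2 : ‖(q - p) - (r / D) • (y - p)‖ ^ 2 = 0 := by
      rw [norm_sub_sq_real, real_inner_smul_right, norm_smul, hp, h3, h6, h5,
        Real.norm_of_nonneg (by positivity)]
      field_simp
      ring
    have := norm_eq_zero.1 (pow_eq_zero_iff two_ne_zero |>.1 h2)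
    rw [sub_sub, sub_eq_zero] at this
    exact this
  obtain ⟨q, hqB, hq⟩ := hBc.exists_infDist_eq_dist hBne y
  refine ⟨q, ⟨hqB, hq.symm⟩, fun z hz => ?_⟩
  rw [key z hz, key q ⟨hqB, hq.symm⟩]

/-- The offset contains the closed ball of radius r about the nearest point of y in A. This ball
contains y, so its translate by -y consists of tangent vectors and spans. -/
theorem isFullyDimensional_offset {A : Set (E d)} (hA : IsClosed A) (hne : A.Nonempty) {r : ℝ}
    (hr : 0 < r) : IsFullyDimensional {y | Metric.infDist y A ≤ r} := by
  intro y hy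
  set B := {y : E d | Metric.infDist y A ≤ r} with hB
  have hBc : IsClosed B := isClosed_le (Metric.continuous_infDist_pt A) continuous_const
  have hyB : Metric.infDist y A ≤ r := hBc.frontier_subset hy
  have hp := norm_sub_nearest hA hne y
  have hpA := nearest_mem hA hne y
  set p := nearest A y
  have hball : Metric.closedBall p r ⊆ B := fun z hz => by
    refine (infDist_le_norm_sub z hpA).trans ?_
    rwa [Metric.mem_closedBall, dist_eq_norm] at hz
  have hyb : y ∈ Metric.closedBall p r := by
    rw [Metric.mem_closedBall, dist_eq_norm, hp]; exact hyB
  have hT : ∀ z ∈ Metric.closedBall p r, z - y ∈ tangentCone B y := by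
    intro z hz
    have hlim : Tendsto (fun k : ℕ => 1 / ((k : ℝ) + 1)) atTop (𝓝 0) :=
      tendsto_one_div_add_atTop_nhds_zero_nat
    refine mem_tangentConeAt_of_seq atTop (fun k : ℕ => (k : ℝ≥0) + 1)
      (fun k : ℕ => (1 / ((k : ℝ) + 1)) • (z - y)) ?_ (Eventually.of_forall fun k => ?_) ?_
    · simpa using hlim.smul_const (z - y)
    · refine hball ((convex_closedBall p r).add_smul_sub_mem hyb hz ⟨by positivity, ?_⟩)
      rw [div_le_one (by positivity)]
      linarith [(Nat.cast_nonneg k : (0 : ℝ) ≤ k)]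
    · refine tendsto_const_nhds.congr fun k => ?_
      rw [NNReal.smul_def, smul_smul]
      push_cast
      rw [mul_one_div_cancel (by positivity), one_smul]
  have hpS : p - y ∈ Submodule.span ℝ (tangentCone B y) :=
    Submodule.subset_span (hT p (Metric.mem_closedBall_self hr.le))
  refine eq_top_iff.2 fun w _ => ?_
  rcases eq_or_ne w 0 with rfl | hw
  · exact zero_mem _
  have hw' : 0 < ‖w‖ := norm_pos_iff.2 hw
  have h1 : (r / ‖w‖) • w ∈ Submodule.span ℝ (tangentCone B y) := by
    have h2 := Submodule.subset_span (R := ℝ) (hT (p + (r / ‖w‖) • w) (by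
      rw [Metric.mem_closedBall, dist_eq_norm, add_sub_cancel_left, norm_smul,
        Real.norm_of_nonneg (by positivity), div_mul_cancel₀ _ hw'.ne']))
    have h3 := Submodule.sub_mem _ h2 hpS
    rwa [show p + (r / ‖w‖) • w - y - (p - y) = (r / ‖w‖) • w by abel] at h3
  have h4 := Submodule.smul_mem _ (‖w‖ / r) h1
  rwa [smul_smul, div_mul_div_cancel₀ hr.ne', div_self hw'.ne', one_smul] at h4

/-! ### The normal bundles of a set and of its erosions -/

/-- The involution `(a, n) ↦ (a + r n, -n)`. -/
def offsetMap (r : ℝ) : (E d × E d) →L[ℝ] (E d × E d) :=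
  (ContinuousLinearMap.fst ℝ (E d) (E d) + r • ContinuousLinearMap.snd ℝ (E d) (E d)).prod
    (-ContinuousLinearMap.snd ℝ (E d) (E d))

@[simp]
theorem offsetMap_apply (r : ℝ) (p : E d × E d) : offsetMap r p = (p.1 + r • p.2, -p.2) := rfl

theorem offsetMap_offsetMap (r : ℝ) (p : E d × E d) : offsetMap r (offsetMap r p) = p := by
  simp

theorem tangentCone_map {V : Type*} [NormedAddCommGroup V] [NormedSpace ℝ V] (φ : V →L[ℝ] V)
    {N M : Set V} {p q v : V} (hN : Set.MapsTo φ N M) (hpq : φ p = q) (hv : v ∈ tangentCone N p) :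
    φ v ∈ tangentCone M q := by
  obtain ⟨α, l, hl, c, u, hu0, hu, hcu⟩ := exists_fun_of_mem_tangentConeAt hv
  refine mem_tangentConeAt_of_seq l c (fun i => φ (u i)) ?_ ?_ ?_
  · have := (φ.continuous.tendsto 0).comp hu0
    rwa [map_zero] at this
  · filter_upwards [hu] with i hi
    rw [← hpq, ← map_add]
    exact hN hi
  · refine ((φ.continuous.tendsto v).comp hcu).congr fun i => ?_
    simp [NNReal.smul_def]

theorem tangentCone_preimage_offsetMap (r : ℝ) (N : Set (E d × E d)) (p : E d × E d) :
    tangentCone (offsetMap r ⁻¹' N) p = offsetMap r ⁻¹' tangentCone N (offsetMap r p) := by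
  refine Set.Subset.antisymm (fun v hv => tangentCone_map _ (fun x hx => hx) rfl hv) fun v hv => ?_
  have h : offsetMap r v ∈ tangentCone N (offsetMap r p) := hv
  have := tangentCone_map (offsetMap r) (M := offsetMap r ⁻¹' N)
    (fun x hx => by rwa [Set.mem_preimage, offsetMap_offsetMap]) (offsetMap_offsetMap r p) h
  rwa [offsetMap_offsetMap] at this

theorem frontier_closedCompl {X : Set (E d)} (hX : IsClosed X) (hreg : closure (interior X) = X) :
    frontier (closedCompl X) = frontier X := by
  rw [closedCompl, ← frontier_compl X, frontier, frontier, closure_closure, closure_compl,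
    interior_compl, hreg, interior_compl, hX.closure_eq]

theorem mem_normalBundle_iff {X : Set (E d)} (p : E d × E d) :
    p ∈ normalBundle X ↔
      p.1 ∈ frontier X ∧ -p.2 ∈ normalConeOfReach (closedCompl X) p.1 ∧ ‖p.2‖ = 1 := by
  refine and_congr_right fun h => ?_
  rw [normalCone, if_neg h.2]
  rfl

/-- This gives X the same form as its erosions, with r = 0, so that later results on `offsetMap r`
serve both. -/
theorem normalBundle_eq_preimage {X : Set (E d)} (hX : IsClosed X)
    (hreg : closure (interior X) = X) :
    normalBundle X = offsetMap 0 ⁻¹' normalBundleOfReach (closedCompl X) := by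
  ext p
  rw [mem_normalBundle_iff, Set.mem_preimage, offsetMap_apply, normalBundleOfReach,
    Set.mem_ofPred_eq, frontier_closedCompl hX hreg]
  simp

section
variable {X A : Set (E d)} {R r : ℝ} (hXA : closedCompl X = A) (hR : 0 < R)
  (hU : HasUniqueNearest A R) (hr : 0 < r) (hrR : r < R)
include hXA hR hU hr hrR

theorem admitsNormalBundle_erosion : AdmitsNormalBundle (erosion X r) := by
  have hA : IsClosed A := hXA ▸ isClosed_closure
  have hne := hU.nonempty hR
  rw [AdmitsNormalBundle, closedCompl_erosion_eq hA hne hXA hr]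
  exact ⟨(hasUniqueNearest_offset hA hR hU hr).reach_pos (sub_pos.2 hrR),
    isFullyDimensional_offset hA hne hr⟩

omit hrR in
theorem mem_frontier_erosion_iff {y : E d} :
    y ∈ frontier (erosion X r) ↔ Metric.infDist y A = r := by
  have hA : IsClosed A := hXA ▸ isClosed_closure
  have hcl : IsClosed (erosion X r) :=
    isClosed_le continuous_const (Metric.continuous_infDist_pt _)
  have h := closedCompl_erosion_eq hA (hU.nonempty hR) hXA hr
  rw [closedCompl] at h
  rw [frontier_eq_closure_inter_closure, hcl.closure_eq, h, erosion, hXA]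
  exact ⟨fun h => le_antisymm h.2 h.1, fun h => ⟨h.ge, h.le⟩⟩

theorem mem_normalConeOfReach_offset {p : E d × E d} (hp : p ∈ normalBundleOfReach A) :
    p.2 ∈ normalConeOfReach (closedCompl (erosion X r)) (p.1 + r • p.2) := by
  have hA : IsClosed A := hXA ▸ isClosed_closure
  have hne := hU.nonempty hR
  obtain ⟨s, hs0, hsR⟩ := exists_between (sub_pos.2 hrR)
  refine mem_polarCone_of_infDist_eq hp.2.2 (s := s) hs0 ?_
  have h := infDist_add_smul_of_mem_normalBundle hA hR hU hp (s := r + s) (by linarith)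
    (by linarith)
  rw [closedCompl_erosion_eq hA hne hXA hr, add_assoc, ← add_smul,
    infDist_offset hA hne hr.le (by rw [h]; linarith), h, add_sub_cancel_left]

/-- Outward normals of the r-offset of A are those of A, carried along: one inclusion extends
normals of A beyond length r, the other recovers the foot point from equality in a triangle
inequality. -/
theorem normalBundle_erosion_eq_preimage :
    normalBundle (erosion X r) = offsetMap r ⁻¹' normalBundleOfReach A := by
  have hA : IsClosed A := hXA ▸ isClosed_closure
  have hne := hU.nonempty hR
  ext ⟨y, n⟩
  rw [mem_normalBundle_iff, mem_frontier_erosion_iff hXA hR hU hr, Set.mem_preimage,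
    offsetMap_apply]
  constructor
  · rintro ⟨hy, hn, hn1⟩
    simp only at hy hn hn1 ⊢
    have hn1' : ‖-n‖ = 1 := by rw [norm_neg, hn1]
    obtain ⟨s, hs0, hsR⟩ := exists_between (sub_pos.2 hrR)
    have hBeq := closedCompl_erosion_eq hA hne hXA hr
    have hBc : IsClosed (closedCompl (erosion X r)) := isClosed_closure
    rw [hBeq] at hn hBc
    -- The offset has reach at least R - r, so its normal -n at y extends by s and reaches distance
    -- r + s from A. As ‖y - p‖ = r, the vector y - p must be r(-n).
    have h1 := infDist_add_smul_of_mem_polarCone hBc (sub_pos.2 hrR)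
      (hasUniqueNearest_offset hA hR hU hr) (show Metric.infDist y A ≤ r from hy.le) hn1' hn
      hs0.le hsR
    have h2 : r ≤ Metric.infDist (y + s • -n) A := by
      by_contra! hlt
      rw [Metric.infDist_zero_of_mem (show y + s • -n ∈ {y | Metric.infDist y A ≤ r} from hlt.le)]
        at h1
      exact hs0.ne h1
    rw [infDist_offset hA hne hr.le h2, sub_eq_iff_eq_add] at h1
    have hp := norm_sub_nearest hA hne y
    have hpA := nearest_mem hA hne y
    set p := nearest A y
    have h3 : s + r ≤ ‖(y - p) + s • -n‖ := by
      rw [← h1, show (y - p) + s • -n = y + s • -n - p by abel]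
      exact infDist_le_norm_sub _ hpA
    have h4 := pow_le_pow_left₀ (by positivity) h3 2
    rw [norm_add_sq_real, real_inner_smul_right, norm_smul, hn1', mul_one, Real.norm_eq_abs,
      sq_abs, hp, hy] at h4
    have h5 : r ≤ ⟪y - p, -n⟫ := le_of_mul_le_mul_left (by nlinarith) hs0
    have h6 : ‖(y - p) - r • -n‖ ^ 2 ≤ 0 := by
      rw [norm_sub_sq_real, real_inner_smul_right, norm_smul, hn1', mul_one, Real.norm_eq_abs,
        sq_abs, hp, hy]
      nlinarith
    have h7 : (y - p) - r • -n = 0 := norm_eq_zero.1 (by nlinarith [norm_nonneg ((y - p) - r • -n)])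
    have h8 : y + r • n = p := by
      rw [smul_neg, sub_neg_eq_add, sub_add_eq_add_sub, sub_eq_zero] at h7
      exact h7
    rw [h8]
    refine mem_normalBundleOfReach_of_infDist_eq hpA hn1' hr ?_
    rw [← h8, smul_neg, add_neg_cancel_right, hy]
  · intro hp
    refine ⟨?_, ?_, by simpa using hp.2.2⟩
    · simpa using infDist_add_smul_of_mem_normalBundle hA hR hU hp hr.le hrR
    · simpa using mem_normalConeOfReach_offset hXA hR hU hr hrR hp

end

/-! ### Tangent vectors of the normal bundle -/

/-- The second components of the bundle stay on the unit sphere. -/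
theorem inner_snd_eq_zero_of_mem_tangentCone {A : Set (E d)} {p w : E d × E d}
    (hp : p ∈ normalBundleOfReach A) (hw : w ∈ tangentCone (normalBundleOfReach A) p) :
    ⟪w.2, p.2⟫ = 0 := by
  obtain ⟨α, l, hl, c, u, hu0, hu, hcu⟩ := exists_fun_of_mem_tangentConeAt hw
  have h2 : Tendsto (fun i => (c i • u i).2) l (𝓝 w.2) := (continuous_snd.tendsto w).comp hcu
  have h0 : Tendsto (fun i => (u i).2) l (𝓝 0) := (continuous_snd.tendsto (0 : E d × E d)).comp hu0
  have ha : Tendsto (fun i => ⟪(c i • u i).2, p.2⟫) l (𝓝 ⟪w.2, p.2⟫) := h2.inner tendsto_const_nhds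
  have hb : Tendsto (fun i => -(‖(c i • u i).2‖ * ‖(u i).2‖) / 2) l (𝓝 0) := by
    simpa using (h2.norm.mul h0.norm).neg.div_const 2
  refine tendsto_nhds_unique ha (hb.congr' ?_)
  filter_upwards [hu] with i hi
  have h1 : ‖p.2 + (u i).2‖ = 1 := hi.2.2
  have h3 : ‖p.2 + (u i).2‖ ^ 2 = 1 := by rw [h1, one_pow]
  rw [norm_add_sq_real, hp.2.2] at h3
  rw [Prod.smul_snd, NNReal.smul_def, real_inner_smul_left, norm_smul,
    Real.norm_of_nonneg (c i).coe_nonneg, real_inner_comm]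
  linear_combination (-(c i : ℝ) / 2) * h3

section
variable {A : Set (E d)} {R : ℝ} (hA : IsClosed A) (hR : 0 < R) (hU : HasUniqueNearest A R)
  {p : E d × E d} (hp : p ∈ normalBundleOfReach A)
include hA hR hU hp

/-- Federer's inequality at p, tested on neighbouring base points, gives one sign; at the
neighbouring pairs, tested on the base point of p, it gives the other. -/
theorem inner_fst_eq_zero_of_mem_tangentCone {w : E d × E d}
    (hw : w ∈ tangentCone (normalBundleOfReach A) p) : ⟪w.1, p.2⟫ = 0 := by
  obtain ⟨s, hs0, hsR⟩ := exists_between hR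
  obtain ⟨α, l, hl, c, u, hu0, hu, hcu⟩ := exists_fun_of_mem_tangentConeAt hw
  have h1 : Tendsto (fun i => (c i • u i).1) l (𝓝 w.1) := (continuous_fst.tendsto w).comp hcu
  have h01 : Tendsto (fun i => (u i).1) l (𝓝 0) := (continuous_fst.tendsto (0 : E d × E d)).comp hu0
  have h02 : Tendsto (fun i => (u i).2) l (𝓝 0) := (continuous_snd.tendsto (0 : E d × E d)).comp hu0
  have ha : Tendsto (fun i => ⟪(c i • u i).1, p.2⟫) l (𝓝 ⟪w.1, p.2⟫) := h1.inner tendsto_const_nhds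
  have hb : Tendsto (fun i => ‖(c i • u i).1‖ * ‖(u i).1‖ / (2 * s)) l (𝓝 0) := by
    simpa using (h1.norm.mul h01.norm).div_const (2 * s)
  have hc : Tendsto (fun i => -(‖(c i • u i).1‖ * ‖(u i).1‖ / (2 * s)) -
      ⟪(c i • u i).1, (u i).2⟫) l (𝓝 0) := by
    simpa using hb.neg.sub (h1.inner h02)
  refine le_antisymm (le_of_tendsto_of_tendsto ha hb ?_) (le_of_tendsto_of_tendsto hc ha ?_)
  · filter_upwards [hu] with i hi
    have h := inner_le_of_infDist_eq (hA.frontier_subset hi.1) hp.2.2 hs0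
      (infDist_add_smul_of_mem_normalBundle hA hR hU hp hs0.le hsR)
    rw [Prod.fst_add, add_sub_cancel_left] at h
    rw [Prod.smul_fst, NNReal.smul_def, real_inner_smul_left, norm_smul,
      Real.norm_of_nonneg (c i).coe_nonneg, real_inner_comm, le_div_iff₀ (by positivity)]
    nlinarith [mul_le_mul_of_nonneg_left h (c i).coe_nonneg]
  · filter_upwards [hu] with i hi
    have h := inner_le_of_infDist_eq (hA.frontier_subset hp.1) hi.2.2 hs0
      (infDist_add_smul_of_mem_normalBundle hA hR hU hi hs0.le hsR)
    rw [Prod.fst_add, Prod.snd_add, sub_add_cancel_left, inner_neg_right, norm_neg,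
      inner_add_left] at h
    rw [Prod.smul_fst, NNReal.smul_def, real_inner_smul_left, real_inner_smul_left, norm_smul,
      Real.norm_of_nonneg (c i).coe_nonneg, real_inner_comm, real_inner_comm p.2, neg_sub_left,
      neg_le, ← sub_le_iff_le_add', le_div_iff₀ (by positivity)]
    nlinarith [mul_le_mul_of_nonneg_left h (c i).coe_nonneg]

/-- This is the infinitesimal form of the Lipschitz bound for the nearest-point map, which sends a +
r n to a. -/
theorem exists_norm_fst_le_of_mem_tangentCone {r : ℝ} (hr : 0 ≤ r) (hrR : r < R) :
    ∃ C : ℝ, ∀ w ∈ tangentCone (normalBundleOfReach A) p, ‖w.1‖ ≤ C * ‖w.1 + r • w.2‖ := by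
  obtain ⟨S, hrS, hSR⟩ := exists_between hrR
  refine ⟨S / (S - r), fun w hw => ?_⟩
  obtain ⟨α, l, hl, c, u, hu0, hu, hcu⟩ := exists_fun_of_mem_tangentConeAt hw
  have h1 : Tendsto (fun i => (c i • u i).1) l (𝓝 w.1) := (continuous_fst.tendsto w).comp hcu
  have h2 : Tendsto (fun i => (c i • u i).2) l (𝓝 w.2) := (continuous_snd.tendsto w).comp hcu
  refine le_of_tendsto_of_tendsto h1.norm ((h1.add (h2.const_smul r)).norm.const_mul _) ?_
  filter_upwards [hu] with i hi
  have h := norm_nearest_sub_le hA hR hU hrS (hr.trans_lt hrS) hSR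
    (infDist_add_smul_of_mem_normalBundle hA hR hU hi hr hrR).le
    (infDist_add_smul_of_mem_normalBundle hA hR hU hp hr hrR).le
  rw [nearest_add_smul_of_mem_normalBundle hA hR hU hi hr hrR,
    nearest_add_smul_of_mem_normalBundle hA hR hU hp hr hrR, Prod.fst_add, Prod.snd_add,
    add_sub_cancel_left, show p.1 + (u i).1 + r • (p.2 + (u i).2) - (p.1 + r • p.2) =
      (u i).1 + r • (u i).2 by rw [smul_add]; abel] at h
  rw [Prod.smul_fst, Prod.smul_snd, NNReal.smul_def, NNReal.smul_def, smul_comm r, ← smul_add,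
    norm_smul, norm_smul, Real.norm_of_nonneg (c i).coe_nonneg, mul_left_comm]
  exact mul_le_mul_of_nonneg_left h (c i).coe_nonneg

theorem eq_zero_of_mem_tangentCone {r : ℝ} (hr : 0 < r) (hrR : r < R) {w : E d × E d}
    (hw : w ∈ tangentCone (normalBundleOfReach A) p) (h0 : w.1 + r • w.2 = 0) : w = 0 := by
  obtain ⟨C, hC⟩ := exists_norm_fst_le_of_mem_tangentCone hA hR hU hp hr.le hrR
  have h1 := hC w hw
  rw [h0, norm_zero, mul_zero, norm_le_zero_iff] at h1
  rw [h1, zero_add, smul_eq_zero] at h0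
  exact Prod.ext h1 (h0.resolve_left hr.ne')

/-- The nearest-point map is differentiable at `a + r n` when the tangent vectors of the normal
bundle at `(a, n)` are linearly related. -/
theorem hasFDerivAt_nearest {r : ℝ} (hr : 0 < r) (hrR : r < R) (L : E d →L[ℝ] E d)
    (hL : ∀ w ∈ tangentCone (normalBundleOfReach A) p, ∀ t : ℝ,
      L (w.1 + r • w.2 + t • p.2) = w.1) :
    HasFDerivAt (nearest A) L (p.1 + r • p.2) := by
  have hne := hU.nonempty hR
  set y₀ := p.1 + r • p.2 with hy₀
  have hd0 : Metric.infDist y₀ A = r :=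
    infDist_add_smul_of_mem_normalBundle hA hR hU hp hr.le hrR
  have hn0 : nearest A y₀ = p.1 := nearest_add_smul_of_mem_normalBundle hA hR hU hp hr.le hrR
  rw [hasFDerivAt_iff_tendsto]
  refine tendsto_of_subseq_tendsto fun y hy => ?_
  obtain ⟨S₁, hrS₁, hS₁R⟩ := exists_between hrR
  obtain ⟨S, hS₁S, hSR⟩ := exists_between hS₁R
  have hdy : Tendsto (fun k => Metric.infDist (y k) A) atTop (𝓝 r) := by
    have := ((Metric.continuous_infDist_pt A).tendsto y₀).comp hy
    rwa [hd0] at this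
  have hny : Tendsto (fun k => nearest A (y k)) atTop (𝓝 p.1) := by
    have := (tendsto_nearest hA hR hU (y := y₀) (by rw [hd0]; exact hrR)).comp hy
    rwa [hn0] at this
  set C := S / (S - S₁) with hC
  have hC0 : 0 ≤ C := div_nonneg (by linarith) (by linarith)
  -- Difference quotients of the point, its nearest point and its distance, bounded by the Lipschitz
  -- estimates. Where y k = y₀ the inverse norm is 0 and so is the quotient, which is harmless.
  set g : ℕ → E d × E d × ℝ := fun k => ‖y k - y₀‖⁻¹ •
    (y k - y₀, nearest A (y k) - p.1, Metric.infDist (y k) A - r) with hg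
  have hgB : ∀ᶠ k in atTop, g k ∈ Metric.closedBall 0 (1 + C) := by
    filter_upwards [hdy.eventually_lt_const hrS₁] with k hk
    have h1 : ‖nearest A (y k) - p.1‖ ≤ C * ‖y k - y₀‖ := by
      rw [← hn0]
      exact norm_nearest_sub_le hA hR hU hS₁S (by linarith) hSR hk.le (by rw [hd0]; exact hrS₁.le)
    have h2 : |Metric.infDist (y k) A - r| ≤ ‖y k - y₀‖ := by
      rw [← hd0, abs_le]
      have e1 := infDist_le_add_norm_sub A (y k) y₀
      have e2 := infDist_le_add_norm_sub A y₀ (y k)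
      rw [norm_sub_rev] at e2
      constructor <;> linarith
    have hy0 := norm_nonneg (y k - y₀)
    rw [mem_closedBall_zero_iff, hg]
    simp only
    rw [norm_smul, norm_inv, norm_norm]
    refine inv_mul_le_of_le_mul₀ hy0 (by positivity) ?_
    refine norm_prod_le_iff.2 ⟨?_, norm_prod_le_iff.2 ⟨?_, ?_⟩⟩
    · nlinarith
    · nlinarith
    · simp only [Real.norm_eq_abs]; nlinarith
  obtain ⟨⟨w, u, t⟩, -, φ, hφ, hlim⟩ :=
    (isCompact_closedBall (0 : E d × E d × ℝ) (1 + C)).tendsto_subseq' hgB.frequently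
  refine ⟨φ, ?_⟩
  have hw : Tendsto (fun k => ‖y (φ k) - y₀‖⁻¹ • (y (φ k) - y₀)) atTop (𝓝 w) :=
    (continuous_fst.tendsto _).comp hlim
  have hu : Tendsto (fun k => ‖y (φ k) - y₀‖⁻¹ • (nearest A (y (φ k)) - p.1)) atTop (𝓝 u) :=
    (continuous_snd.fst.tendsto _).comp hlim
  have ht : Tendsto (fun k => ‖y (φ k) - y₀‖⁻¹ • (Metric.infDist (y (φ k)) A - r)) atTop (𝓝 t) :=
    (continuous_snd.snd.tendsto _).comp hlim
  have hyφ := hy.comp hφ.tendsto_atTop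
  have hdφ := hdy.comp hφ.tendsto_atTop
  have hnφ := hny.comp hφ.tendsto_atTop
  set n : ℕ → E d := fun k =>
    (Metric.infDist (y (φ k)) A)⁻¹ • (y (φ k) - nearest A (y (φ k))) with hn
  have hnlim : Tendsto n atTop (𝓝 p.2) := by
    have := (hdφ.inv₀ hr.ne').smul (hyφ.sub hnφ)
    rwa [hy₀, add_sub_cancel_left, smul_smul, inv_mul_cancel₀ hr.ne', one_smul] at this
  have hdpos : ∀ᶠ k in atTop, 0 < Metric.infDist (y (φ k)) A := hdφ.eventually_const_lt hr
  have hv : Tendsto (fun k => ‖y (φ k) - y₀‖⁻¹ • (n k - p.2)) atTop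
      (𝓝 (r⁻¹ • (w - u - t • p.2))) := by
    refine ((hdφ.inv₀ hr.ne').smul ((hw.sub hu).sub (ht.smul_const p.2))).congr' ?_
    filter_upwards [hdpos] with k hk
    simp only [Function.comp, hn, hy₀, smul_eq_mul]
    set D := Metric.infDist (y (φ k)) A
    rw [mul_smul, ← smul_sub, ← smul_sub, smul_comm]
    congr 1
    rw [show y (φ k) - (p.1 + r • p.2) - (nearest A (y (φ k)) - p.1) - (D - r) • p.2 =
      (y (φ k) - nearest A (y (φ k))) - D • p.2 by rw [sub_smul]; abel, smul_sub, smul_smul,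
      inv_mul_cancel₀ hk.ne', one_smul]
  -- The limits u and w of the quotients of nearest point and point are related through a tangent
  -- vector of the bundle: w = u + r v + t n. Hence L w = u, for every subsequential limit.
  have hmem : (u, r⁻¹ • (w - u - t • p.2)) ∈ tangentCone (normalBundleOfReach A) p := by
    refine mem_tangentConeAt_of_seq atTop (fun k => (‖y (φ k) - y₀‖⁻¹).toNNReal)
      (fun k => (nearest A (y (φ k)), n k) - p) ?_ ?_ ?_
    · have h := (hnφ.prodMk_nhds hnlim).sub_const p
      rwa [Prod.mk.eta, sub_self] at h
    · filter_upwards [hdpos] with k hk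
      rw [add_sub_cancel]
      exact mem_normalBundle_nearest hA hR hU hk
    · refine (hu.prodMk_nhds hv).congr fun k => ?_
      rw [NNReal.smul_def, Real.coe_toNNReal _ (by positivity)]
      rfl
  have hLw : L w = u := by
    have h := hL _ hmem t
    rwa [smul_smul, mul_inv_cancel₀ hr.ne', one_smul, show u + (w - u - t • p.2) + t • p.2 = w by
      abel] at h
  have hfin := (hu.sub ((L.continuous.tendsto w).comp hw)).norm
  rw [hLw, sub_self, norm_zero] at hfin
  refine hfin.congr fun k => ?_
  simp only [Function.comp, map_smul]
  rw [← smul_sub, norm_smul, norm_inv, norm_norm, hn0]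

end

/-- The nearest-point map is a gradient. -/
theorem hasFDerivAt_potential {A : Set (E d)} {R : ℝ} (hA : IsClosed A) (hR : 0 < R)
    (hU : HasUniqueNearest A R) {y : E d} (hy : Metric.infDist y A < R) :
    HasFDerivAt (fun z => (‖z‖ ^ 2 - Metric.infDist z A ^ 2) / 2)
      ((isBoundedBilinearMap_inner (𝕜 := ℝ) (E := E d)).toContinuousLinearMap (nearest A y)) y := by
  have hne := hU.nonempty hR
  -- The potential is the supremum over a in A of ⟨z, a⟩ - ‖a‖²/2, so it is convex with the nearest
  -- point as a subgradient. Continuity of this subgradient gives differentiability.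
  have key : ∀ z z' : E d, ⟪nearest A z, z' - z⟫ ≤ (‖z'‖ ^ 2 - Metric.infDist z' A ^ 2) / 2 -
      (‖z‖ ^ 2 - Metric.infDist z A ^ 2) / 2 := by
    intro z z'
    have h1 := pow_le_pow_left₀ Metric.infDist_nonneg
      (infDist_le_norm_sub z' (nearest_mem hA hne z)) 2
    rw [norm_sub_sq_real] at h1
    have h2 : Metric.infDist z A ^ 2 = ‖z - nearest A z‖ ^ 2 := by rw [norm_sub_nearest hA hne]
    rw [norm_sub_sq_real] at h2
    rw [inner_sub_right, real_inner_comm z', real_inner_comm z]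
    linarith
  rw [hasFDerivAt_iff_isLittleO, Asymptotics.isLittleO_iff]
  intro c hc
  have hev := (tendsto_nearest hA hR hU hy).eventually (Metric.ball_mem_nhds _ hc)
  filter_upwards [hev] with z hz
  rw [dist_eq_norm] at hz
  have h1 := key y z
  have h2 := key z y
  have h3 : ⟪nearest A z - nearest A y, z - y⟫ ≤ c * ‖z - y‖ :=
    (real_inner_le_norm _ _).trans (mul_le_mul_of_nonneg_right hz.le (norm_nonneg _))
  rw [← neg_sub z y, inner_neg_right] at h2
  rw [inner_sub_left] at h3
  change |_ - _ - ⟪nearest A y, z - y⟫| ≤ _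
  rw [abs_le]
  constructor <;> nlinarith [norm_nonneg (z - y)]

section
variable {A : Set (E d)} {R : ℝ} (hA : IsClosed A) (hR : 0 < R) (hU : HasUniqueNearest A R)
  {p : E d × E d} (hp : p ∈ normalBundleOfReach A) {T : Submodule ℝ (E d × E d)}
  (hT : (T : Set (E d × E d)) = tangentCone (normalBundleOfReach A) p)
  (hdim : Module.finrank ℝ T + 1 = d)
include hA hR hU hp hT hdim

/-- The tangent space of the normal bundle at a regular pair is isotropic. -/
theorem inner_tangent_comm {w w' : E d × E d} (hw : w ∈ T) (hw' : w' ∈ T) :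
    ⟪w.1, w'.2⟫ = ⟪w'.1, w.2⟫ := by
  obtain ⟨r, hr, hrR⟩ := exists_between hR
  have hmem : ∀ w ∈ T, w ∈ tangentCone (normalBundleOfReach A) p := fun w hw => by
    rw [← hT]; exact hw
  -- Vectors u + r v are orthogonal to n, so adding the line along n gives an injective map from
  -- dimension (d - 1) + 1 onto the whole space. Its inverse followed by the first projection is the
  -- derivative L of the nearest-point map.
  let Φ : (T × ℝ) →ₗ[ℝ] E d :=
    ((LinearMap.fst ℝ (E d) (E d) + r • LinearMap.snd ℝ (E d) (E d)) ∘ₗ T.subtype).coprod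
      (LinearMap.toSpanSingleton ℝ (E d) p.2)
  have hΦ : ∀ (w : T) (t : ℝ), Φ (w, t) = (w : E d × E d).1 + r • (w : E d × E d).2 + t • p.2 :=
    fun w t => by simp [Φ]
  have hinj : Function.Injective Φ := by
    rw [← LinearMap.ker_eq_bot, LinearMap.ker_eq_bot']
    rintro ⟨w, t⟩ h0
    rw [hΦ] at h0
    have h1 := inner_fst_eq_zero_of_mem_tangentCone hA hR hU hp (hmem _ w.2)
    have h2 := inner_snd_eq_zero_of_mem_tangentCone hp (hmem _ w.2)
    have ht : t = 0 := by
      have h3 : ⟪(w : E d × E d).1 + r • (w : E d × E d).2 + t • p.2, p.2⟫ = 0 := by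
        rw [h0, inner_zero_left]
      rw [inner_add_left, inner_add_left, real_inner_smul_left, real_inner_smul_left, h1, h2,
        real_inner_self_eq_norm_sq, hp.2.2] at h3
      simpa using h3
    rw [ht, zero_smul, add_zero] at h0
    have hw0 := eq_zero_of_mem_tangentCone hA hR hU hp hr hrR (hmem _ w.2) h0
    rw [ht, Prod.mk_eq_zero]
    exact ⟨Subtype.ext hw0, rfl⟩
  let e : (T × ℝ) ≃ₗ[ℝ] E d := LinearEquiv.ofInjectiveOfFinrankEq Φ hinj (by
    rw [Module.finrank_prod, Module.finrank_self, hdim, finrank_euclideanSpace_fin])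
  let L : E d →L[ℝ] E d := LinearMap.toContinuousLinearMap
    (LinearMap.fst ℝ (E d) (E d) ∘ₗ T.subtype ∘ₗ LinearMap.fst ℝ T ℝ ∘ₗ e.symm.toLinearMap)
  have hL : ∀ w ∈ tangentCone (normalBundleOfReach A) p, ∀ t : ℝ,
      L (w.1 + r • w.2 + t • p.2) = w.1 := by
    intro w hw t
    rw [← hT] at hw
    have h1 : e (⟨w, hw⟩, t) = w.1 + r • w.2 + t • p.2 := hΦ ⟨w, hw⟩ t
    rw [← h1]
    simp [L]
  have hder := hasFDerivAt_nearest hA hR hU hp hr hrR L hL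
  set B := (isBoundedBilinearMap_inner (𝕜 := ℝ) (E := E d)).toContinuousLinearMap with hB
  have hnear : ∀ᶠ y in 𝓝 (p.1 + r • p.2), Metric.infDist y A < R := by
    refine (Metric.continuous_infDist_pt A).continuousAt.eventually_lt_const ?_
    change Metric.infDist _ A < R
    rwa [infDist_add_smul_of_mem_normalBundle hA hR hU hp hr.le hrR]
  -- Second derivatives of the potential are symmetric: ⟨u, u' + r v'⟩ = ⟨u', u + r v⟩, and the
  -- terms ⟨u, u'⟩ cancel.
  have hsymm := second_derivative_symmetric_of_eventually (𝕜 := ℝ)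
    (hnear.mono fun y hy => hasFDerivAt_potential hA hR hU hy)
    (B.hasFDerivAt.comp _ hder) (w.1 + r • w.2) (w'.1 + r • w'.2)
  have hLw := hL w (hmem _ hw) 0
  have hLw' := hL w' (hmem _ hw') 0
  rw [zero_smul, add_zero] at hLw hLw'
  change ⟪L (w.1 + r • w.2), w'.1 + r • w'.2⟫ = ⟪L (w'.1 + r • w'.2), w.1 + r • w.2⟫ at hsymm
  rw [hLw, hLw', inner_add_right, inner_add_right, real_inner_smul_right, real_inner_smul_right,
    real_inner_comm] at hsymm
  exact mul_left_cancel₀ hr.ne' (add_left_cancel hsymm)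

end

/-! ### Definite subspaces of symmetric bilinear forms -/

section
variable {V : Type*} [AddCommGroup V] [Module ℝ V] [FiniteDimensional ℝ V]
  {B : LinearMap.BilinForm ℝ V}

omit [FiniteDimensional ℝ V] in
theorem apply_self_eq_sum {ι : Type*} [Fintype ι] (v : Module.Basis ι ℝ V) (hv : B.IsOrthoᵢ v)
    (w : V) : B w w = ∑ i, (v.repr w i) ^ 2 * B (v i) (v i) := by
  classical
  conv_lhs => rw [← v.sum_repr w]
  simp only [map_sum, LinearMap.sum_apply, map_smul, LinearMap.smul_apply, smul_eq_mul]
  refine Finset.sum_congr rfl fun i _ => ?_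
  rw [Finset.sum_eq_single i]
  · ring
  · intro j _ hji
    have h0 : B (v j) (v i) = 0 := hv hji
    simp [h0]
  · simp

omit [FiniteDimensional ℝ V] in
theorem apply_self_pos_of_mem_span {ι : Type*} [Fintype ι] (v : Module.Basis ι ℝ V)
    (hv : B.IsOrthoᵢ v) {s : Set ι} (hs : ∀ i ∈ s, 0 < B (v i) (v i)) {w : V}
    (hw : w ∈ Submodule.span ℝ (v '' s)) (hw0 : w ≠ 0) : 0 < B w w := by
  rw [v.mem_span_image] at hw
  have hc : ∀ i, v.repr w i ≠ 0 → 0 < B (v i) (v i) := fun i hi =>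
    hs i (hw (Finsupp.mem_support_iff.2 hi))
  rw [apply_self_eq_sum v hv]
  have hne : ∃ i, v.repr w i ≠ 0 := by
    by_contra! h
    exact hw0 (v.repr.map_eq_zero_iff.1 (Finsupp.ext h))
  obtain ⟨i, hi⟩ := hne
  refine Finset.sum_pos' (fun j _ => ?_) ⟨i, Finset.mem_univ i, ?_⟩
  · rcases eq_or_ne (v.repr w j) 0 with h | h
    · simp [h]
    · exact mul_nonneg (sq_nonneg _) (hc j h).le
  · exact mul_pos (pow_pos (abs_pos.2 hi) 2 |>.trans_eq (sq_abs _)) (hc i hi)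

/-- A nondegenerate symmetric form splits the space into positive and negative definite parts. -/
theorem exists_posDef_sup_negDef (hB : LinearMap.IsSymm B) (hnd : B.Nondegenerate) :
    ∃ P N : Submodule ℝ V, P ⊔ N = ⊤ ∧ (∀ w ∈ P, w ≠ 0 → 0 < B w w) ∧
      ∀ w ∈ N, w ≠ 0 → B w w < 0 := by
  obtain ⟨v, hv⟩ := LinearMap.BilinForm.exists_orthogonal_basis hB
  have hne : ∀ i, B (v i) (v i) ≠ 0 := fun i =>
    LinearMap.BilinForm.iIsOrtho.not_isOrtho_basis_self_of_nondegenerate hv hnd i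
  refine ⟨Submodule.span ℝ (v '' {i | 0 < B (v i) (v i)}),
    Submodule.span ℝ (v '' {i | B (v i) (v i) < 0}), ?_,
    fun w hw hw0 => apply_self_pos_of_mem_span v hv (fun i hi => hi) hw hw0, fun w hw hw0 => ?_⟩
  · rw [← Submodule.span_union, ← Set.image_union, eq_top_iff, ← v.span_eq]
    refine Submodule.span_mono ?_
    rintro _ ⟨i, rfl⟩
    exact ⟨i, (lt_or_gt_of_ne (hne i)).symm, rfl⟩
  · have hv' : (-B).IsOrthoᵢ v := fun i j hij => by
      have h0 : B (v i) (v j) = 0 := hv hij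
      show (-B) (v i) (v j) = 0
      simp [h0]
    have := apply_self_pos_of_mem_span v hv' (fun i hi => by simpa using hi) hw hw0
    simpa using this

variable {P N : Submodule ℝ V} (hPN : P ⊔ N = ⊤) (hP : ∀ w ∈ P, w ≠ 0 → 0 < B w w)
  (hN : ∀ w ∈ N, w ≠ 0 → B w w < 0)
include hP hN

omit [FiniteDimensional ℝ V] in
theorem disjoint_posDef_negDef : Disjoint P N := by
  rw [Submodule.disjoint_def]
  intro w hwP hwN
  by_contra h0
  exact lt_asymm (hP w hwP h0) (hN w hwN h0)

include hPN

theorem finrank_posDef_add_negDef :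
    Module.finrank ℝ P + Module.finrank ℝ N = Module.finrank ℝ V :=
  Submodule.finrank_add_eq_of_isCompl
    ⟨disjoint_posDef_negDef hP hN, codisjoint_iff.2 hPN⟩

/-- A negative definite subspace meets P only in 0, so its dimension is at most the codimension of
P, which is the dimension of N. The bound also ensures that the supremum in ℕ is not the default
value 0. -/
theorem index_eq_finrank : index B = Module.finrank ℝ N := by
  have hbound : ∀ k ∈ {k | ∃ W : Submodule ℝ V, Module.finrank ℝ W = k ∧
      ∀ w ∈ W, w ≠ 0 → B w w < 0}, k ≤ Module.finrank ℝ N := by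
    rintro k ⟨W, rfl, hW⟩
    have h1 := Submodule.finrank_add_finrank_le_of_disjoint (disjoint_posDef_negDef hP hW)
    have h2 := finrank_posDef_add_negDef hPN hP hN
    omega
  exact le_antisymm (csSup_le ⟨_, N, rfl, hN⟩ hbound) (le_csSup ⟨_, hbound⟩ ⟨N, rfl, hN⟩)

omit [FiniteDimensional ℝ V] in
theorem nondegenerate_of_posDef_negDef (hB : LinearMap.IsSymm B) : B.Nondegenerate := by
  have hsep : B.SeparatingLeft := by
    intro w hw
    obtain ⟨p, hp, n, hn, rfl⟩ := Submodule.mem_sup.1 (hPN ▸ Submodule.mem_top : w ∈ P ⊔ N)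
    -- By symmetry B(p + n, p - n) = B(p, p) - B(n, n), a sum of two nonnegative terms.
    have h1 := hw (p - n)
    have h2 : B n p = B p n := hB.eq n p
    simp only [map_add, map_sub, LinearMap.add_apply, h2] at h1
    have hpp : 0 ≤ B p p := by
      rcases eq_or_ne p 0 with rfl | h
      · simp
      · exact (hP p hp h).le
    have hnn : B n n ≤ 0 := by
      rcases eq_or_ne n 0 with rfl | h
      · simp
      · exact (hN n hn h).le
    have hp0 : p = 0 := by
      by_contra h
      have := hP p hp h
      linarith
    have hn0 : n = 0 := by
      by_contra h
      have := hN n hn h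
      linarith
    rw [hp0, hn0, add_zero]
  exact ⟨hsep, fun w hw => hsep w fun z => (hB.eq z w).symm.trans (hw z)⟩

end

/-! ### Perturbation of definite forms -/

section
variable {V : Type*} [NormedAddCommGroup V] [NormedSpace ℝ V] [FiniteDimensional ℝ V]

/-- Positive definiteness is stable under continuous perturbations. -/
theorem eventually_pos_of_continuous {Q : ℝ → V → ℝ} (hQ : Continuous fun p : ℝ × V => Q p.1 p.2)
    (hsmul : ∀ t c v, Q t (c • v) = c ^ 2 * Q t v) (hpos : ∀ v, v ≠ 0 → 0 < Q 0 v) :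
    ∀ᶠ t in 𝓝 (0 : ℝ), ∀ v, v ≠ 0 → 0 < Q t v := by
  have : ProperSpace V := FiniteDimensional.proper ℝ V
  have h : ∀ᶠ t in 𝓝 (0 : ℝ), ∀ v ∈ Metric.sphere (0 : V) 1, 0 < Q t v := by
    refine (isCompact_sphere (0 : V) 1).eventually_forall_of_forall_eventually fun v hv => ?_
    have hv0 : v ≠ 0 := ne_zero_of_mem_unit_sphere ⟨v, hv⟩
    exact hQ.continuousAt.eventually (lt_mem_nhds (hpos v hv0))
  filter_upwards [h] with t ht v hv
  have hv' : 0 < ‖v‖ := norm_pos_iff.2 hv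
  have h1 := ht (‖v‖⁻¹ • v) (by
    rw [mem_sphere_zero_iff_norm, norm_smul, norm_inv, norm_norm, inv_mul_cancel₀ hv'.ne'])
  rw [hsmul] at h1
  exact pos_of_mul_pos_right h1 (sq_nonneg _)

variable (H : E d →L[ℝ] E d →L[ℝ] ℝ) (g : ℝ) (α β : V →ₗ[ℝ] E d)

/-- The quadratic form induced on the tangent space of the normal bundle by the Hessian of the
restriction to an offset. -/
def offsetForm (r : ℝ) (p : V) : ℝ :=
  H (α p + r • β p) (α p + r • β p) - g * ⟪α p + r • β p, β p⟫

theorem eventually_offsetForm_pos (hpos : ∀ p, p ≠ 0 → 0 < offsetForm H g α β 0 p) :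
    ∀ᶠ r in 𝓝 (0 : ℝ), ∀ p, p ≠ 0 → 0 < offsetForm H g α β r p := by
  refine eventually_pos_of_continuous ?_ (fun r c p => ?_) hpos
  · have hα := α.continuous_of_finiteDimensional
    have hβ := β.continuous_of_finiteDimensional
    unfold offsetForm
    fun_prop
  · simp only [offsetForm, map_smul]
    rw [smul_comm r c, ← smul_add]
    simp only [map_smul, smul_apply, real_inner_smul_left,
      real_inner_smul_right, smul_eq_mul]
    ring

variable {g}

/-- At r = 0 the form vanishes on the kernel of α, so compactness alone does not suffice: there the
form is of order r, elsewhere of order 1. Scaling the kernel directions by √r puts both at the same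
order, with a definite limit. -/
theorem eventually_offsetForm_neg (hg : 0 < g) (hiso : ∀ p q, ⟪α p, β q⟫ = ⟪α q, β p⟫)
    (hinj : ∀ p, α p = 0 → β p = 0 → p = 0)
    (hneg : ∀ p, α p ≠ 0 → offsetForm H g α β 0 p < 0) :
    ∀ᶠ r in 𝓝[>] (0 : ℝ), ∀ p, p ≠ 0 → offsetForm H g α β r p < 0 := by
  obtain ⟨s, hs⟩ := α.rangeRestrict.exists_rightInverse_of_surjective α.range_rangeRestrict
  -- e replaces p by a chosen representative with the same α-value and kills the kernel of α. Thus γ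
  -- is the part of β that factors through α, and ζ is the vertical remainder.
  set e : V →ₗ[ℝ] V := s ∘ₗ α.rangeRestrict with he
  have hαe : ∀ p, α (e p) = α p := fun p =>
    congrArg Subtype.val (LinearMap.congr_fun hs (α.rangeRestrict p))
  have he0 : ∀ p, α p = 0 → e p = 0 := fun p hp => by
    have : α.rangeRestrict p = 0 := Subtype.ext hp
    rw [he, LinearMap.comp_apply, this, map_zero]
  set γ : V →ₗ[ℝ] E d := β ∘ₗ e with hγ
  set ζ : V →ₗ[ℝ] E d := β - γ with hζ
  have hβ : ∀ p, β p = γ p + ζ p := fun p => by simp [hζ]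
  -- Isotropy moves α onto p - e p, which lies in its kernel; this removes the cross term that would
  -- have order √r after division by r.
  have hαζ : ∀ p, ⟪α p, ζ p⟫ = 0 := fun p => by
    have h1 : ⟪α p, β (p - e p)⟫ = 0 := by rw [hiso, map_sub, hαe, sub_self, inner_zero_left]
    simpa [hζ, hγ] using h1
  -- The negated form after the substitution r = t², with vertical part divided by t. It is
  -- continuous up to t = 0, where it equals g‖ζ p‖² minus the form at r = 0.
  set Q : ℝ → V → ℝ := fun t p => g * (⟪α p, γ p⟫ + t ^ 2 * ⟪γ p, γ p⟫ + 2 * t * ⟪γ p, ζ p⟫ +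
    ⟪ζ p, ζ p⟫) - H (α p + t ^ 2 • γ p + t • ζ p) (α p + t ^ 2 • γ p + t • ζ p) with hQ
  have hQev : ∀ᶠ t in 𝓝 (0 : ℝ), ∀ p, p ≠ 0 → 0 < Q t p := by
    refine eventually_pos_of_continuous ?_ (fun t c p => ?_) fun p hp => ?_
    · have hα := α.continuous_of_finiteDimensional
      have hγ := γ.continuous_of_finiteDimensional
      have hζ := ζ.continuous_of_finiteDimensional
      simp only [hQ]
      fun_prop
    · simp only [hQ, map_smul]
      rw [smul_comm t c, smul_comm (t ^ 2) c, ← smul_add, ← smul_add]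
      simp only [map_smul, smul_apply, real_inner_smul_left,
        real_inner_smul_right, smul_eq_mul]
      ring
    · have h0 : Q 0 p = g * ⟪ζ p, ζ p⟫ - offsetForm H g α β 0 p := by
        have h1 : ⟪α p, β p⟫ = ⟪α p, γ p⟫ := by rw [hβ, inner_add_right, hαζ, add_zero]
        simp only [hQ, offsetForm, ne_eq, OfNat.ofNat_ne_zero, not_false_eq_true, zero_pow,
          zero_smul, add_zero, h1]
        ring
      rw [h0]
      rcases eq_or_ne (α p) 0 with hα | hα
      · have h1 : offsetForm H g α β 0 p = 0 := by simp [offsetForm, hα]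
        have h2 : ζ p ≠ 0 := fun h => hp (hinj p hα (by
          rw [hβ, h, add_zero, hγ, LinearMap.comp_apply, he0 p hα, map_zero]))
        rw [h1, sub_zero]
        exact mul_pos hg (real_inner_self_pos.2 h2)
      · have h1 := hneg p hα
        have h2 : 0 ≤ g * ⟪ζ p, ζ p⟫ := mul_nonneg hg.le real_inner_self_nonneg
        linarith
  have hsqrt : Tendsto Real.sqrt (𝓝[>] 0) (𝓝 0) := by
    have := Real.continuous_sqrt.tendsto 0
    rw [Real.sqrt_zero] at this
    exact this.mono_left nhdsWithin_le_nhds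
  filter_upwards [hsqrt.eventually hQev, self_mem_nhdsWithin] with r hr hr0 p hp
  have hr0' : 0 < r := hr0
  have ht0 : 0 < √r := Real.sqrt_pos.2 hr0'
  have ht2 : √r ^ 2 = r := Real.sq_sqrt hr0'.le
  set t := √r
  -- The vertical part of p is multiplied by t = √r, so that Q t q is the negated form at p.
  set q := e p + t • (p - e p) with hq
  have hαq : α q = α p := by simp [hq, hαe]
  have heq : e q = e p := by
    rw [← sub_eq_zero, ← map_sub]
    exact he0 _ (by rw [map_sub, hαq, sub_self])
  have hγq : γ q = γ p := congrArg β heq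
  have hζq : ζ q = t • ζ p := by
    have h1 : β q = γ p + t • ζ p := by simp [hq, hζ, hγ]
    rw [hζ, LinearMap.sub_apply, hγq, h1, add_sub_cancel_left]
  have hq0 : q ≠ 0 := fun h => by
    have h1 : α p = 0 := by rw [← hαq, h, map_zero]
    have h2 : t • ζ p = 0 := by rw [← hζq, h, map_zero]
    have h3 : ζ p = 0 := (smul_eq_zero.1 h2).resolve_left ht0.ne'
    exact hp (hinj p h1 (by rw [hβ, h3, add_zero, hγ, LinearMap.comp_apply, he0 p h1, map_zero]))
  have hpos := hr q hq0
  have hval : Q t q = -offsetForm H g α β r p := by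
    simp only [hQ, hαq, hγq, hζq, offsetForm]
    rw [hβ, smul_smul, ← pow_two, ht2, smul_add, ← add_assoc]
    have h4 : ⟪α p + r • γ p + r • ζ p, γ p + ζ p⟫ = ⟪α p, γ p⟫ + r * ⟪γ p, γ p⟫ +
        2 * r * ⟪γ p, ζ p⟫ + r * ⟪ζ p, ζ p⟫ := by
      simp only [inner_add_left, inner_add_right, real_inner_smul_left, hαζ]
      rw [real_inner_comm (γ p) (ζ p)]
      ring
    rw [h4]
    simp only [real_inner_smul_left, real_inner_smul_right]
    rw [← ht2]
    ring
  rw [hval] at hpos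
  linarith

theorem eventually_offsetForm_pos_of_mem (g : ℝ) (W : Submodule ℝ V)
    (hpos : ∀ p ∈ W, p ≠ 0 → 0 < offsetForm H g α β 0 p) :
    ∀ᶠ r in 𝓝 (0 : ℝ), ∀ p ∈ W, p ≠ 0 → 0 < offsetForm H g α β r p := by
  filter_upwards [eventually_offsetForm_pos H g (α ∘ₗ W.subtype) (β ∘ₗ W.subtype)
    fun p hp => hpos p p.2 (by simpa using hp)] with r hr p hp hp0
  exact hr ⟨p, hp⟩ fun h => hp0 (congrArg Subtype.val h)

theorem eventually_offsetForm_neg_of_mem (hg : 0 < g) (hiso : ∀ p q, ⟪α p, β q⟫ = ⟪α q, β p⟫)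
    (hinj : ∀ p, α p = 0 → β p = 0 → p = 0) (W : Submodule ℝ V)
    (hneg : ∀ p ∈ W, α p ≠ 0 → offsetForm H g α β 0 p < 0) :
    ∀ᶠ r in 𝓝[>] (0 : ℝ), ∀ p ∈ W, p ≠ 0 → offsetForm H g α β r p < 0 := by
  filter_upwards [eventually_offsetForm_neg H (α ∘ₗ W.subtype) (β ∘ₗ W.subtype) hg
    (fun p q => hiso p q) (fun p h1 h2 => Subtype.ext (hinj p h1 h2))
    fun p hp => hneg p p.2 hp] with r hr p hp hp0
  exact hr ⟨p, hp⟩ fun h => hp0 (congrArg Subtype.val h)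

end

/-! ### Principal curvatures -/

/-- Encoding a curvature by a point (c, s) of the unit circle treats finite and infinite values
alike. -/
theorem exists_principalVector_eq (κ : WithTop ℝ) : ∃ c s : ℝ, c ^ 2 + s ^ 2 = 1 ∧
    (c = 0 ↔ κ = ⊤) ∧ ∀ b : E d, principalVector κ b = (c • b, s • b) := by
  induction κ using WithTop.recTopCoe with
  | top => exact ⟨0, 1, by norm_num, by simp, fun b => by simp [principalVector]⟩
  | coe k =>
    have h : 0 < 1 + k ^ 2 := by positivity
    refine ⟨1 / √(1 + k ^ 2), k / √(1 + k ^ 2), ?_, ?_, fun b => rfl⟩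
    · rw [div_pow, div_pow, Real.sq_sqrt h.le, ← add_div, one_pow, div_self h.ne']
    · simp [(Real.sqrt_pos.2 h).ne']

theorem inner_toLp_eq (v w : E d × E d) :
    ⟪WithLp.toLp 2 v, WithLp.toLp 2 w⟫ = ⟪v.1, w.1⟫ + ⟪v.2, w.2⟫ := rfl

theorem linearIndependent_of_orthonormal_toLp {ι : Type*} {v : ι → E d × E d}
    (hv : Orthonormal ℝ fun i => WithLp.toLp 2 (v i)) : LinearIndependent ℝ v :=
  hv.linearIndependent.map' (WithLp.linearEquiv 2 ℝ (E d × E d)).toLinearMap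
    (LinearEquiv.ker _)

section
variable {T : Submodule ℝ (E d × E d)}
  (hiso : ∀ w ∈ T, ∀ w' ∈ T, ⟪w.1, w'.2⟫ = ⟪w'.1, w.2⟫)
include hiso

/-- An isotropic space which is transverse to the space `u + r v = 0` has an orthonormal basis of
principal vectors. -/
theorem exists_principalVector_basis (hdim : Module.finrank ℝ T + 1 = d) {n : E d} (hn : n ≠ 0)
    (h1 : ∀ w ∈ T, ⟪w.1, n⟫ = 0) (h2 : ∀ w ∈ T, ⟪w.2, n⟫ = 0) {r : ℝ} (hr : r ≠ 0)
    (hinj : ∀ w ∈ T, w.1 + r • w.2 = 0 → w = 0) :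
    ∃ (κ : Fin (d - 1) → WithTop ℝ) (b : Fin (d - 1) → E d), (∀ i, ⟪b i, n⟫ = 0) ∧
      Orthonormal ℝ (fun i => WithLp.toLp 2 (principalVector (κ i) (b i))) ∧
      Submodule.span ℝ (Set.range fun i => principalVector (κ i) (b i)) = T := by
  set W : Submodule ℝ (E d) := (ℝ ∙ n)ᗮ with hWdef
  have hmemW : ∀ u : E d, ⟪u, n⟫ = 0 → u ∈ W := fun u hu =>
    Submodule.mem_orthogonal_singleton_iff_inner_left.2 hu
  have hWdim : Module.finrank ℝ W = d - 1 := by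
    have : Fact (Module.finrank ℝ (E d) = (d - 1) + 1) := ⟨by
      rw [finrank_euclideanSpace_fin]; omega⟩
    exact Submodule.finrank_orthogonal_span_singleton hn
  let π : T →ₗ[ℝ] W := (LinearMap.fst ℝ (E d) (E d) ∘ₗ T.subtype).codRestrict W
    fun w => hmemW _ (h1 _ w.2)
  let ψ : T →ₗ[ℝ] W :=
    ((LinearMap.fst ℝ (E d) (E d) + r • LinearMap.snd ℝ (E d) (E d)) ∘ₗ T.subtype).codRestrict W
      fun w => hmemW _ (by
        simp [inner_add_left, real_inner_smul_left, h1 _ w.2, h2 _ w.2])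
  have hψ : ∀ w, (ψ w : E d) = (w : E d × E d).1 + r • (w : E d × E d).2 := fun w => rfl
  have hπ : ∀ w, (π w : E d) = (w : E d × E d).1 := fun w => rfl
  have hψinj : Function.Injective ψ := by
    rw [← LinearMap.ker_eq_bot, LinearMap.ker_eq_bot']
    exact fun w hw => Subtype.ext (hinj _ w.2 (by rw [← hψ, hw]; rfl))
  let e : T ≃ₗ[ℝ] W := LinearEquiv.ofInjectiveOfFinrankEq ψ hψinj (by omega)
  have he : ∀ w, e w = ψ w := fun w => rfl
  -- S sends u + r v to u and is symmetric by isotropy. An eigenvector b with eigenvalue l gives (l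
  -- b, ((1 - l)/r) b) in T, hence curvature (1 - l)/(r l), infinite exactly when l = 0.
  let S : W →ₗ[ℝ] W := π ∘ₗ e.symm.toLinearMap
  have hS : S.IsSymmetric := by
    intro a b
    obtain ⟨p, rfl⟩ := e.surjective a
    obtain ⟨q, rfl⟩ := e.surjective b
    simp only [S, LinearMap.comp_apply, LinearEquiv.coe_coe, LinearEquiv.symm_apply_apply,
      Submodule.coe_inner]
    simp only [he, hψ, hπ, inner_add_left, inner_add_right, real_inner_smul_left,
      real_inner_smul_right]
    rw [hiso _ p.2 _ q.2, real_inner_comm (q : E d × E d).1 (p : E d × E d).2]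
  set e' := hS.eigenvectorBasis hWdim with he'
  set l := hS.eigenvalues hWdim with hl
  have heig : ∀ i, S (e' i) = l i • e' i := fun i => hS.apply_eigenvectorBasis hWdim i
  set b : Fin (d - 1) → E d := fun i => e' i with hb
  have hbon : Orthonormal ℝ b := e'.orthonormal.comp_linearIsometry W.subtypeₗᵢ
  have hmem : ∀ i, (l i • b i, ((1 - l i) / r) • b i) ∈ T := by
    intro i
    set w := e.symm (e' i) with hw
    have hw1 : (w : E d × E d).1 = l i • b i := by
      have := congrArg Subtype.val (heig i)
      exact this
    have hw2 : (w : E d × E d).1 + r • (w : E d × E d).2 = b i := by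
      rw [← hψ, ← he, hw, LinearEquiv.apply_symm_apply]
    have hw3 : (w : E d × E d).2 = ((1 - l i) / r) • b i := by
      have h3 : r • (w : E d × E d).2 = (1 - l i) • b i := by
        rw [sub_smul, one_smul, ← hw1, ← hw2, add_sub_cancel_left]
      rw [div_eq_inv_mul, mul_smul, ← h3, smul_smul, inv_mul_cancel₀ hr, one_smul]
    rw [← hw1, ← hw3]
    exact w.2
  set κ : Fin (d - 1) → WithTop ℝ := fun i =>
    if l i = 0 then ⊤ else (((1 - l i) / (r * l i) : ℝ) : WithTop ℝ) with hκ
  have hpT : ∀ i, principalVector (κ i) (b i) ∈ T := by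
    intro i
    by_cases h0 : l i = 0
    · have h3 := T.smul_mem r (hmem i)
      rw [h0, zero_smul, Prod.smul_mk, smul_zero, smul_smul, sub_zero, mul_one_div_cancel hr,
        one_smul] at h3
      simpa [hκ, h0, principalVector] using h3
    · set k := (1 - l i) / (r * l i) with hk
      have h3 := T.smul_mem (1 / √(1 + k ^ 2) / l i) (hmem i)
      rw [Prod.smul_mk, smul_smul, smul_smul, div_mul_cancel₀ _ h0,
        show 1 / √(1 + k ^ 2) / l i * ((1 - l i) / r) = k / √(1 + k ^ 2) by
          have : √(1 + k ^ 2) ≠ 0 := (Real.sqrt_pos.2 (by positivity)).ne'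
          generalize √(1 + k ^ 2) = z at this
          rw [hk]; field_simp] at h3
      have h4 : κ i = (k : WithTop ℝ) := if_neg h0
      rw [h4]
      exact h3
  have hon : Orthonormal ℝ (fun i => WithLp.toLp 2 (principalVector (κ i) (b i))) := by
    rw [orthonormal_iff_ite] at hbon ⊢
    intro i j
    obtain ⟨c, s, hcs, -, hp⟩ := exists_principalVector_eq (d := d) (κ i)
    obtain ⟨c', s', -, -, hp'⟩ := exists_principalVector_eq (d := d) (κ j)
    rw [inner_toLp_eq, hp, hp']
    simp only [real_inner_smul_left, real_inner_smul_right, hbon i j]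
    split_ifs with hij
    · subst hij
      have h3 := (hp (b i)).symm.trans (hp' (b i))
      rw [Prod.mk.injEq] at h3
      have hbi : b i ≠ 0 := fun h => by
        have := hbon i i
        rw [h, inner_zero_left, if_pos rfl] at this
        exact zero_ne_one this
      rw [← smul_left_injective ℝ hbi h3.1, ← smul_left_injective ℝ hbi h3.2]
      linarith
    · simp
  refine ⟨κ, b, fun i => Submodule.mem_orthogonal_singleton_iff_inner_left.1 (e' i).2, hon, ?_⟩
  refine Submodule.eq_of_le_of_finrank_eq (Submodule.span_le.2 ?_) ?_
  · rintro _ ⟨i, rfl⟩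
    exact hpT i
  · rw [finrank_span_eq_card (linearIndependent_of_orthonormal_toLp hon), Fintype.card_fin]
    omega

/-- The infinite principal curvatures count the dimension lost by projecting onto the base. -/
theorem finrank_firstProj_add_numInfinite {m : ℕ} {κ : Fin m → WithTop ℝ} {b : Fin m → E d}
    (hon : Orthonormal ℝ (fun i => WithLp.toLp 2 (principalVector (κ i) (b i))))
    (hspan : Submodule.span ℝ (Set.range fun i => principalVector (κ i) (b i)) = T) :
    Module.finrank ℝ (firstProj T) + numInfinite κ = Module.finrank ℝ T := by
  classical
  have hTdim : Module.finrank ℝ T = m := by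
    rw [← hspan, finrank_span_eq_card (linearIndependent_of_orthonormal_toLp hon), Fintype.card_fin]
  choose c s hcs hc hp using fun i => exists_principalVector_eq (d := d) (κ i)
  have hmem : ∀ i, (c i • b i, s i • b i) ∈ T := fun i => by
    rw [← hp, ← hspan]
    exact Submodule.subset_span ⟨i, rfl⟩
  rw [orthonormal_iff_ite] at hon
  -- Only the pairs are assumed orthonormal. Orthogonality of the pairs and isotropy kill (c c' + s
  -- s')⟨b, b'⟩ and (c s' - c' s)⟨b, b'⟩, and the squares of the two coefficients sum to 1.
  have hbij : ∀ i j, i ≠ j → ⟪b i, b j⟫ = 0 := by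
    intro i j hij
    have h1 := hon i j
    rw [inner_toLp_eq, hp, hp, if_neg hij] at h1
    have h2 := hiso _ (hmem i) _ (hmem j)
    simp only [real_inner_smul_left, real_inner_smul_right] at h1 h2
    rw [real_inner_comm (b i) (b j)] at h2
    by_contra h0
    have e1 : c i * c j + s i * s j = 0 :=
      (mul_eq_zero.1 (show (c i * c j + s i * s j) * ⟪b i, b j⟫ = 0 by linarith)).resolve_right h0
    have e2 : c i * s j - c j * s i = 0 :=
      (mul_eq_zero.1 (show (c i * s j - c j * s i) * ⟪b i, b j⟫ = 0 by linarith)).resolve_right h0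
    have : (c i ^ 2 + s i ^ 2) * (c j ^ 2 + s j ^ 2) = 0 := by
      linear_combination (c i * c j + s i * s j) * e1 + (c i * s j - c j * s i) * e2
    rw [hcs, hcs] at this
    norm_num at this
  have hb0 : ∀ i, b i ≠ 0 := fun i h => by
    have h1 := hon i i
    rw [inner_toLp_eq, hp, h, if_pos rfl] at h1
    simp at h1
  have hb : LinearIndependent ℝ b := linearIndependent_of_ne_zero_of_inner_eq_zero hb0 hbij
  have hfp : firstProj T = Submodule.span ℝ (Set.range fun i : {i // ¬ κ i = ⊤} => b i) := by
    rw [← hspan, firstProj, Submodule.map_span]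
    refine le_antisymm (Submodule.span_le.2 ?_) (Submodule.span_le.2 ?_)
    · rintro _ ⟨_, ⟨i, rfl⟩, rfl⟩
      simp only [hp, LinearMap.fst_apply]
      by_cases h : κ i = ⊤
      · rw [(hc i).2 h, zero_smul]
        exact zero_mem _
      · exact Submodule.smul_mem _ _ (Submodule.subset_span ⟨⟨i, h⟩, rfl⟩)
    · rintro _ ⟨⟨i, h⟩, rfl⟩
      have h1 : c i • b i ∈ Submodule.span ℝ (LinearMap.fst ℝ (E d) (E d) ''
          Set.range fun i => principalVector (κ i) (b i)) :=
        Submodule.subset_span ⟨_, ⟨i, rfl⟩, by simp only [hp, LinearMap.fst_apply]⟩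
      have h2 := Submodule.smul_mem _ (c i)⁻¹ h1
      rwa [smul_smul, inv_mul_cancel₀ (mt (hc i).1 h), one_smul] at h2
  have hnum : numInfinite κ = Fintype.card {i // κ i = ⊤} := by
    rw [numInfinite, ← Nat.card_coe_set_eq, ← Nat.card_eq_fintype_card]
    rfl
  have hsub : LinearIndependent ℝ fun i : {i // ¬ κ i = ⊤} => b i :=
    hb.comp _ Subtype.val_injective
  rw [hTdim, hfp, finrank_span_eq_card hsub, hnum,
    Fintype.card_subtype_compl, Fintype.card_fin]
  have := Fintype.card_subtype_le (fun i : Fin m => κ i = ⊤)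
  rw [Fintype.card_fin] at this
  omega

end

/-! ### Tangent spaces and Hessians of offsets -/

theorem restrictedHessian_toFirstProj {f : E d → ℝ} {X : Set (E d)} {x : E d}
    (h : ∀ p ∈ criticalTangentSpace f X x, ∀ w : E d,
      ((0 : E d), w) ∈ criticalTangentSpace f X x → ⟪p.1, w⟫ = 0)
    (p q : criticalTangentSpace f X x) :
    restrictedHessian f X x (toFirstProj _ p) (toFirstProj _ q) =
      fderiv ℝ (fderiv ℝ f) x (p : E d × E d).1 (q : E d × E d).1 +
        ‖gradient f x‖ * ⟪(p : E d × E d).1, (q : E d × E d).2⟫ := by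
  rw [← secondFundamentalForm_apply _ h]
  rfl

theorem finrank_comap_offsetMap (T : Submodule ℝ (E d × E d)) (r : ℝ) :
    Module.finrank ℝ (T.comap (offsetMap r).toLinearMap) = Module.finrank ℝ T := by
  let e : (E d × E d) ≃ₗ[ℝ] (E d × E d) :=
    LinearEquiv.ofInvolutive (offsetMap r).toLinearMap (offsetMap_offsetMap r)
  change Module.finrank ℝ (T.comap e.toLinearMap) = _
  rw [Submodule.comap_equiv_eq_map_symm]
  exact LinearEquiv.finrank_map_eq e.symm T

section
variable {T S : Submodule ℝ (E d × E d)} {r : ℝ} (hS : S = T.comap (offsetMap r).toLinearMap)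

/-- The map `(u, v) ↦ u + r v` onto the projection of the tangent space of an offset. -/
def offsetProj : T →ₗ[ℝ] firstProj S :=
  toFirstProj S ∘ₗ ((offsetMap r).toLinearMap ∘ₗ T.subtype).codRestrict S fun p => by
    rw [hS, Submodule.mem_comap]
    change offsetMap r (offsetMap r (p : E d × E d)) ∈ T
    rw [offsetMap_offsetMap]
    exact p.2

theorem offsetProj_apply (p : T) :
    (offsetProj hS p : E d) = (p : E d × E d).1 + r • (p : E d × E d).2 := rfl

theorem offsetProj_surjective : Function.Surjective (offsetProj hS) := by
  rintro ⟨_, ⟨w, hw, rfl⟩⟩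
  have hw' : offsetMap r w ∈ T := by
    have := hw
    rw [SetLike.mem_coe, hS, Submodule.mem_comap] at this
    exact this
  refine ⟨⟨offsetMap r w, hw'⟩, Subtype.ext ?_⟩
  rw [offsetProj_apply]
  simp

end

section
variable {T : Submodule ℝ (E d × E d)} (hiso : ∀ w ∈ T, ∀ w' ∈ T, ⟪w.1, w'.2⟫ = ⟪w'.1, w.2⟫)
  {f : E d → ℝ} (hf : ContDiff ℝ 2 f) {X : Set (E d)} {x : E d} {r : ℝ}
  (hS : criticalTangentSpace f X x = T.comap (offsetMap r).toLinearMap)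
include hiso

/-- The minus sign comes from `offsetMap r`, which reverses the second component. -/
theorem restrictedHessian_offsetProj (p q : T) :
    restrictedHessian f X x (offsetProj hS p) (offsetProj hS q) =
      fderiv ℝ (fderiv ℝ f) x ((p : E d × E d).1 + r • (p : E d × E d).2)
        ((q : E d × E d).1 + r • (q : E d × E d).2) -
        ‖gradient f x‖ * ⟪(p : E d × E d).1 + r • (p : E d × E d).2, (q : E d × E d).2⟫ := by
  have h : ∀ p ∈ criticalTangentSpace f X x, ∀ w : E d,
      ((0 : E d), w) ∈ criticalTangentSpace f X x → ⟪p.1, w⟫ = 0 := by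
    intro a ha w hw
    rw [hS, Submodule.mem_comap] at ha hw
    have h1 := hiso _ ha _ hw
    simp only [ContinuousLinearMap.coe_coe, offsetMap_apply, zero_add, inner_add_left,
      inner_neg_right, real_inner_smul_left] at h1
    rw [real_inner_comm w a.2] at h1
    linarith
  refine (restrictedHessian_toFirstProj h _ _).trans ?_
  rw [sub_eq_add_neg, ← mul_neg, ← inner_neg_right]
  rfl

include hf hS in
theorem restrictedHessian_isSymm : LinearMap.IsSymm (restrictedHessian f X x) := by
  refine ⟨fun a b => ?_⟩
  obtain ⟨p, rfl⟩ := offsetProj_surjective hS a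
  obtain ⟨q, rfl⟩ := offsetProj_surjective hS b
  rw [RingHom.id_apply, restrictedHessian_offsetProj hiso, restrictedHessian_offsetProj hiso]
  have hsymm : IsSymmSndFDerivAt ℝ f x := hf.contDiffAt.isSymmSndFDerivAt (by simp)
  rw [hsymm.eq, inner_add_left, inner_add_left, hiso _ p.2 _ q.2, real_inner_smul_left,
    real_inner_smul_left, real_inner_comm (p : E d × E d).2 (q : E d × E d).1,
    real_inner_comm (p : E d × E d).2 (q : E d × E d).2]

/-- The index of the Hessian of the restriction to small offsets. -/
theorem eventually_index_restrictedHessian (hS₀ : criticalTangentSpace f X x =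
      T.comap (offsetMap 0).toLinearMap) (hf : ContDiff ℝ 2 f) (hg : gradient f x ≠ 0)
    (hnd : (restrictedHessian f X x).Nondegenerate) :
    ∀ᶠ r in 𝓝[>] (0 : ℝ), ∀ (f' : E d → ℝ) (X' : Set (E d)) (x' : E d), ContDiff ℝ 2 f' →
      fderiv ℝ (fderiv ℝ f') x' = fderiv ℝ (fderiv ℝ f) x → gradient f' x' = gradient f x →
      criticalTangentSpace f' X' x' = T.comap (offsetMap r).toLinearMap →
      (∀ w ∈ T, w.1 + r • w.2 = 0 → w = 0) →
      (restrictedHessian f' X' x').Nondegenerate ∧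
        index (restrictedHessian f' X' x') + Module.finrank ℝ (firstProj T) =
          index (restrictedHessian f X x) + Module.finrank ℝ T := by
  set H := fderiv ℝ (fderiv ℝ f) x
  have hg' : 0 < ‖gradient f x‖ := norm_pos_iff.2 hg
  obtain ⟨P, N, hPN, hP, hN⟩ :=
    exists_posDef_sup_negDef (restrictedHessian_isSymm hiso hf hS₀) hnd
  set ψ := offsetProj hS₀ with hψdef
  have hψ : ∀ p, (ψ p : E d) = (p : E d × E d).1 := fun p => by
    rw [hψdef, offsetProj_apply, zero_smul, add_zero]
  obtain ⟨s, hs⟩ := ψ.exists_rightInverse_of_surjective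
    (LinearMap.range_eq_top.2 (offsetProj_surjective hS₀))
  have hψs : ∀ a, ψ (s a) = a := fun a => LinearMap.congr_fun hs a
  -- P is lifted by a section, while N is pulled back entirely: N' contains the kernel of ψ, that
  -- is, the vertical vectors, which become negative directions for r > 0.
  set P' : Submodule ℝ T := P.map s with hP'
  set N' : Submodule ℝ T := N.comap ψ with hN'
  have hPN' : P' ⊔ N' = ⊤ := by
    refine eq_top_iff.2 fun p _ => ?_
    obtain ⟨a, ha, b, hb, hab⟩ := Submodule.mem_sup.1 (hPN ▸ Submodule.mem_top : ψ p ∈ P ⊔ N)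
    refine Submodule.mem_sup.2 ⟨s a, Submodule.mem_map_of_mem ha, p - s a, ?_, by abel⟩
    rw [hN', Submodule.mem_comap, map_sub, hψs, ← hab, add_sub_cancel_left]
    exact hb
  have hP'dim : Module.finrank ℝ P' = Module.finrank ℝ P :=
    (Submodule.equivMapOfInjective s (Function.LeftInverse.injective hψs) P).finrank_eq.symm
  have hF : Module.finrank ℝ (firstProj T) =
      Module.finrank ℝ (firstProj (criticalTangentSpace f X x)) := by
    have h : firstProj (criticalTangentSpace f X x) = firstProj T := by
      ext u
      constructor
      · intro hu
        obtain ⟨p, hp⟩ := offsetProj_surjective hS₀ ⟨u, hu⟩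
        exact ⟨p, p.2, by rw [LinearMap.fst_apply, ← hψ, hψdef, hp]⟩
      · rintro ⟨p, hp, rfl⟩
        rw [LinearMap.fst_apply, ← hψ ⟨p, hp⟩]
        exact (ψ ⟨p, hp⟩).2
    rw [h]
  let α : T →ₗ[ℝ] E d := LinearMap.fst ℝ (E d) (E d) ∘ₗ T.subtype
  let β : T →ₗ[ℝ] E d := LinearMap.snd ℝ (E d) (E d) ∘ₗ T.subtype
  have hform₀ : ∀ p : T, offsetForm H ‖gradient f x‖ α β 0 p =
      restrictedHessian f X x (ψ p) (ψ p) := fun p =>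
    (restrictedHessian_offsetProj hiso hS₀ p p).symm
  have hevP := eventually_offsetForm_pos_of_mem H α β ‖gradient f x‖ P' (by
    rintro _ ⟨a, ha, rfl⟩ h0
    rw [hform₀, hψs]
    exact hP a ha fun h => h0 (by rw [h, map_zero]))
  have hevN := eventually_offsetForm_neg_of_mem H α β hg' (fun p q => hiso _ p.2 _ q.2)
    (fun p h1 h2 => Subtype.ext (Prod.ext h1 h2)) N' (fun p hp hp0 => by
      rw [hform₀]
      exact hN _ hp fun h => hp0 (by rw [show α p = (ψ p : E d) from (hψ p).symm, h]; rfl))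
  filter_upwards [hevP.filter_mono nhdsWithin_le_nhds, hevN] with r hrP hrN f' X' x' hf' hH hgr hS
    hinj
  set χ := offsetProj hS with hχdef
  have hχinj : Function.Injective χ := by
    rw [← LinearMap.ker_eq_bot, LinearMap.ker_eq_bot']
    intro p hp
    refine Subtype.ext (hinj _ p.2 ?_)
    rw [← offsetProj_apply hS, ← hχdef, hp]
    rfl
  have hform : ∀ p : T, restrictedHessian f' X' x' (χ p) (χ p) =
      offsetForm H ‖gradient f x‖ α β r p := fun p => by
    rw [restrictedHessian_offsetProj hiso hS, hH, hgr]
    rfl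
  have hsup : P'.map χ ⊔ N'.map χ = ⊤ := by
    rw [← Submodule.map_sup, hPN', Submodule.map_top,
      LinearMap.range_eq_top.2 (offsetProj_surjective hS)]
  have hpos : ∀ w ∈ P'.map χ, w ≠ 0 → 0 < restrictedHessian f' X' x' w w := by
    rintro _ ⟨p, hp, rfl⟩ h0
    rw [hform]
    exact hrP p hp fun h => h0 (by rw [h, map_zero])
  have hneg : ∀ w ∈ N'.map χ, w ≠ 0 → restrictedHessian f' X' x' w w < 0 := by
    rintro _ ⟨p, hp, rfl⟩ h0
    rw [hform]
    exact hrN p hp fun h => h0 (by rw [h, map_zero])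
  refine ⟨nondegenerate_of_posDef_negDef hsup hpos hneg
    (restrictedHessian_isSymm hiso hf' hS), ?_⟩
  have e1 := finrank_posDef_add_negDef hsup hpos hneg
  have e2 := finrank_posDef_add_negDef hPN hP hN
  have e3 : Module.finrank ℝ (P'.map χ) = Module.finrank ℝ P' :=
    (Submodule.equivMapOfInjective χ hχinj P').finrank_eq.symm
  have e4 : Module.finrank ℝ (firstProj (criticalTangentSpace f' X' x')) = Module.finrank ℝ T :=
    (LinearEquiv.ofBijective χ ⟨hχinj, offsetProj_surjective hS⟩).finrank_eq.symm
  -- Both indices are total dimension minus dimension of the positive part. The positive parts have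
  -- equal dimension, and the totals are dim T and dim π₀(T).
  rw [index_eq_finrank hsup hpos hneg, index_eq_finrank hPN hP hN]
  omega

end

section
variable {N : Set (E d × E d)} {X : Set (E d)} {r : ℝ} {T : Submodule ℝ (E d × E d)}
  {p : E d × E d} (hN : normalBundle X = offsetMap r ⁻¹' N)
  (hT : (T : Set (E d × E d)) = tangentCone N (offsetMap r p))
include hN hT

theorem coe_comap_offsetMap : (T.comap (offsetMap r).toLinearMap : Set (E d × E d)) =
    tangentCone (normalBundle X) p := by
  rw [hN, tangentCone_preimage_offsetMap, ← hT]
  rfl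

theorem tangentSpace_eq_comap :
    tangentSpace (normalBundle X) p = T.comap (offsetMap r).toLinearMap := by
  rw [tangentSpace, ← coe_comap_offsetMap hN hT, Submodule.span_eq]

theorem isRegularPair_of_offset (hp : offsetMap r p ∈ N) (hdim : Module.finrank ℝ T + 1 = d) :
    IsRegularPair (normalBundle X) p :=
  ⟨by rw [hN]; exact hp, _, coe_comap_offsetMap hN hT, by rw [finrank_comap_offsetMap, hdim]⟩

end

/-! ### Translated functions -/

theorem fderiv_translatedFun (f : E d → ℝ) (x : E d) (r : ℝ) (y : E d) :
    fderiv ℝ (translatedFun f x r) y = fderiv ℝ f (y - r • unitGradient f x) :=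
  fderiv_comp_sub _

theorem gradient_translatedFun (f : E d → ℝ) (x : E d) (r : ℝ) :
    gradient (translatedFun f x r) (translatedPoint f x r) = gradient f x := by
  rw [gradient, gradient, fderiv_translatedFun, translatedPoint, add_sub_cancel_right]

theorem fderiv_fderiv_translatedFun (f : E d → ℝ) (x : E d) (r : ℝ) :
    fderiv ℝ (fderiv ℝ (translatedFun f x r)) (translatedPoint f x r) =
      fderiv ℝ (fderiv ℝ f) x := by
  have h : fderiv ℝ (translatedFun f x r) = fun y => fderiv ℝ f (y - r • unitGradient f x) :=
    funext fun y => fderiv_translatedFun f x r y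
  rw [h, fderiv_comp_sub, translatedPoint, add_sub_cancel_right]

theorem unitGradient_translatedFun (f : E d → ℝ) (x : E d) (r : ℝ) :
    unitGradient (translatedFun f x r) (translatedPoint f x r) = unitGradient f x := by
  rw [unitGradient, gradient_translatedFun, unitGradient]

theorem contDiff_translatedFun {f : E d → ℝ} (hf : ContDiff ℝ 2 f) (x : E d) (r : ℝ) :
    ContDiff ℝ 2 (translatedFun f x r) :=
  hf.comp (contDiff_id.sub contDiff_const)

theorem isCriticalPoint_of_mem_normalBundle {f : E d → ℝ} {X : Set (E d)} {x : E d} (hx : x ∈ X)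
    (hg : gradient f x ≠ 0) (h : (x, -unitGradient f x) ∈ normalBundle X) :
    IsCriticalPoint f X x := by
  refine ⟨hx, ?_⟩
  obtain ⟨h1, h2, -⟩ := (mem_normalBundle_iff _).1 h
  have hint : x ∉ interior X := h1.2
  rw [normalCone, if_neg hint]
  intro b hb
  have h3 := h2 b hb
  have hg' : 0 < ‖gradient f x‖ := norm_pos_iff.2 hg
  rw [neg_neg, unitGradient, real_inner_smul_left] at h3
  rw [neg_neg]
  exact nonpos_of_mul_nonpos_right h3 (inv_pos.2 hg')

end ComplementaryRegular
end

/-! ### Assembly of the theorem -/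

open ComplementaryRegular in
theorem mainTheorem10 (d : ℕ) (X : Set (E d)) (hX : IsComplementaryRegular X)
    (f : E d → ℝ) (hf : ContDiff ℝ 2 f) (x : E d) (hx : IsNondegenerateCriticalPoint f X x) :
    (∀ r : ℝ, 0 < r → ENNReal.ofReal r < reach (closedCompl X) →
      AdmitsNormalBundle (erosion X r) ∧
      IsCriticalPoint (translatedFun f x r) (erosion X r) (translatedPoint f x r) ∧
      translatedFun f x r (translatedPoint f x r) = f x) ∧
    (∃ κ b, IsPrincipalCurvatures (normalBundleOfReach (closedCompl X)) x (unitGradient f x) κ b) ∧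
    ∃ r₀ > 0, ∀ r : ℝ, 0 < r → r < r₀ →
      IsNondegenerateCriticalPoint (translatedFun f x r) (erosion X r) (translatedPoint f x r) ∧
      ∀ κ b, IsPrincipalCurvatures (normalBundleOfReach (closedCompl X)) x (unitGradient f x) κ b →
        index (restrictedHessian (translatedFun f x r) (erosion X r) (translatedPoint f x r)) =
          index (restrictedHessian f X x) + numInfinite κ := by
  set A := closedCompl X with hXA
  have hA : IsClosed A := isClosed_closure
  set ν := unitGradient f x with hν
  have hN₀ := normalBundle_eq_preimage hX.isCompact.isClosed hX.closure_interior
  obtain ⟨hmem₀, T₀, hT₀, hdim₀⟩ := hx.isRegularPair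
  have hp : (x, ν) ∈ normalBundleOfReach A := by
    rw [hN₀] at hmem₀
    simpa using hmem₀
  have hoff : ∀ r, offsetMap r (translatedPoint f x r, -ν) = (x, ν) := fun r => by
    simp [translatedPoint, hν]
  have hmemr : ∀ r R, 0 < r → r < R → HasUniqueNearest A R →
      (translatedPoint f x r, -ν) ∈ normalBundle (erosion X r) := fun r R hr hrR hU => by
    rw [normalBundle_erosion_eq_preimage hXA.symm (hr.trans hrR) hU hr hrR, Set.mem_preimage, hoff]
    exact hp
  have hcrit : ∀ r R, 0 < r → r < R → HasUniqueNearest A R →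
      IsCriticalPoint (translatedFun f x r) (erosion X r) (translatedPoint f x r) :=
    fun r R hr hrR hU => by
      refine isCriticalPoint_of_mem_normalBundle ?_ ?_ ?_
      · exact (infDist_add_smul_of_mem_normalBundle hA (hr.trans hrR) hU hp hr.le hrR).ge
      · rw [gradient_translatedFun]
        exact hx.gradient_ne_zero
      · rw [unitGradient_translatedFun]
        exact hmemr r R hr hrR hU
  refine ⟨fun r hr hrA => ?_, ?_⟩
  · obtain ⟨R, hrR, hU⟩ := exists_hasUniqueNearest_of_lt_reach hr.le hrA
    refine ⟨admitsNormalBundle_erosion hXA.symm (hr.trans hrR) hU hr hrR, hcrit r R hr hrR hU, ?_⟩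
    rw [translatedFun, translatedPoint, add_sub_cancel_right]
  obtain ⟨R, hR, hU⟩ := exists_hasUniqueNearest_of_lt_reach (A := A) le_rfl
    (by rw [ENNReal.ofReal_zero]; exact hX.reach_compl_pos)
  -- Regularity is given for Nor(X); flipping the normal transfers its tangent space to Nor(A) at
  -- (x, ν).
  set T : Submodule ℝ (E d × E d) := T₀.comap (offsetMap 0).toLinearMap with hTdef
  have hT : (T : Set (E d × E d)) = tangentCone (normalBundleOfReach A) (x, ν) := by
    have h1 := tangentCone_preimage_offsetMap 0 (normalBundleOfReach A) (x, -ν)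
    rw [← hN₀, ← hT₀] at h1
    have h2 : offsetMap 0 (x, -ν) = (x, ν) := by simp
    rw [h2] at h1
    ext w
    rw [hTdef, SetLike.mem_coe, Submodule.mem_comap, ← SetLike.mem_coe, h1]
    change offsetMap 0 (offsetMap 0 w) ∈ tangentCone (normalBundleOfReach A) (x, ν) ↔ _
    rw [offsetMap_offsetMap]
  have hdim : Module.finrank ℝ T + 1 = d := by rw [hTdef, finrank_comap_offsetMap, hdim₀]
  have hmemT : ∀ w ∈ T, w ∈ tangentCone (normalBundleOfReach A) (x, ν) := fun w hw => by
    rw [← hT]; exact hw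
  have hiso : ∀ w ∈ T, ∀ w' ∈ T, ⟪w.1, w'.2⟫ = ⟪w'.1, w.2⟫ := fun w hw w' hw' =>
    inner_tangent_comm hA hR hU hp hT hdim hw hw'
  have hinj : ∀ r, 0 < r → r < R → ∀ w ∈ T, w.1 + r • w.2 = 0 → w = 0 := fun r hr hrR w hw h0 =>
    eq_zero_of_mem_tangentCone hA hR hU hp hr hrR (hmemT w hw) h0
  refine ⟨?_, ?_⟩
  · have hν0 : ν ≠ 0 := norm_ne_zero_iff.1 (by rw [show ‖ν‖ = 1 from hp.2.2]; exact one_ne_zero)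
    obtain ⟨κ, b, h1, h2, h3⟩ := exists_principalVector_basis hiso hdim hν0
      (fun w hw => inner_fst_eq_zero_of_mem_tangentCone hA hR hU hp (hmemT w hw))
      (fun w hw => inner_snd_eq_zero_of_mem_tangentCone hp (hmemT w hw))
      (half_pos hR).ne' (hinj _ (half_pos hR) (half_lt_self hR))
    exact ⟨κ, b, h1, h2, by rw [h3, hT]⟩
  have hS₀ : criticalTangentSpace f X x = T.comap (offsetMap 0).toLinearMap :=
    tangentSpace_eq_comap hN₀ (by rw [hT, offsetMap_apply]; simp [hν, hXA])
  have hev := eventually_index_restrictedHessian hiso hS₀ hf hx.gradient_ne_zero hx.nondegenerate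
  obtain ⟨ε, hε, hball⟩ := mem_nhdsGT_iff_exists_Ioo_subset.1 hev
  -- Below R the bundle of the erosion is the offset copy of Nor(A) and u + r v is injective on T;
  -- below ε the signs of the form are settled.
  refine ⟨min ε R, lt_min hε hR, fun r hr hrmin => ?_⟩
  have hrε : r < ε := hrmin.trans_le (min_le_left _ _)
  have hrR : r < R := hrmin.trans_le (min_le_right _ _)
  have hNr := normalBundle_erosion_eq_preimage hXA.symm hR hU hr hrR
  have hTr : (T : Set (E d × E d)) = tangentCone (normalBundleOfReach A)
      (offsetMap r (translatedPoint f x r, -ν)) := by rw [hoff, hT]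
  have hSr : criticalTangentSpace (translatedFun f x r) (erosion X r) (translatedPoint f x r) =
      T.comap (offsetMap r).toLinearMap := by
    rw [criticalTangentSpace, unitGradient_translatedFun]
    exact tangentSpace_eq_comap hNr hTr
  obtain ⟨hnd, hidx⟩ := hball ⟨hr, hrε⟩ (translatedFun f x r) (erosion X r) (translatedPoint f x r)
    (contDiff_translatedFun hf x r) (fderiv_fderiv_translatedFun f x r)
    (gradient_translatedFun f x r) hSr (hinj r hr hrR)
  refine ⟨⟨hcrit r R hr hrR hU, ?_, ?_, hnd⟩, fun κ b hκ => ?_⟩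
  · rw [gradient_translatedFun]
    exact hx.gradient_ne_zero
  · rw [unitGradient_translatedFun]
    exact isRegularPair_of_offset hNr hTr (by rw [hoff]; exact hp) hdim
  -- The index grows by dim T - dim π₀(T), which is the number of infinite curvatures in any
  -- admissible family.
  · have h1 := finrank_firstProj_add_numInfinite hiso hκ.orthonormal
      (SetLike.coe_injective (hκ.span_eq.trans hT.symm))
    omega
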